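/- Let $\Gamma$ be a torsion-free abelian group and let $E=\bigoplus_{\gamma\in\Gamma}E_\gamma$ be a graded division ring, i.e. a nonzero $\Gamma$-graded ring in which every nonzero homogeneous element is invertible. Assume that $E$ is finite dimensional (finitely generated as a module) over its center $T=Z(E)$. Let $T_0=T\cap E_0$, let $E^*$, $E_0^*$, $T_0^*$ be the unit groups, and let $\Gamma_E$ and $\Gamma_T$ be the groups of degrees of the nonzero homogeneous elements of $E$ and of $T$. For $A=E$ or $A=E_0$ let $\operatorname{Nrd}_A\colon A\to Z(A)$ be the reduced norm, i.e. the multiplicative map that becomes the determinant after a faithfully flat base change $Z(A)\to S$ and an isomorphism $A\otimes_{Z(A)}S\cong M_n(S)$. Let $\operatorname{ind}(A)=\sqrt{[A:Z(A)]}$, let $A^{(1)}=\{a\in A^*:\operatorname{Nrd}_A(a)=1\}$, and let $SK_1(A)=A^{(1)}/[A^*,A^*]$. Put $$\delta=\operatorname{ind}(E)\big/\big(\operatorname{ind}(E_0)\,[Z(E_0):T_0]\big),\qquad G=\operatorname{Gal}(Z(E_0)/T_0),\qquad \widetilde N=N_{Z(E_0)/T_0}\circ\operatorname{Nrd}_{E_0}\colon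 E_0^*\to T_0^*,$$ let $\mu_\delta(T_0)$ be the group of $\delta$-th roots of unity in $T_0$, and let $[E_0^*,E^*]$ be the subgroup of $E^*$ generated by all $aba^{-1}b^{-1}$ with $a\in E_0^*$, $b\in E^*$. For a $G$-module $A$, written multiplicatively, let $\widehat H^{-1}(G,A)=\ker(N_G)/I_G(A)$, where $N_G(a)=\prod_{g\in G}g(a)$ and $I_G(A)$ is generated by all $a\,g(a)^{-1}$ with $a\in A$, $g\in G$. Then these objects are well defined: the reduced norms of $E$ and $E_0$ exist and are unique, $\operatorname{ind}(E)$ and $\operatorname{ind}(E_0)$ are integers, $\operatorname{ind}(E)>0$, $\delta$ is an integer, $Z(E_0)$ and $T_0$ are fields, $Z(E_0)/T_0$ is Galois with finite group $G$, $\operatorname{Nrd}_{E_0}(E_0^*)$ is a $G$-submodule of $Z(E_0)^*$, $[E_0^*,E^*]\subseteq\ker\widetilde N$, $[E_0^*,E^*]\subseteq E^{(1)}$, and $E^{(1)}\subseteq E_0^*$. Moreover there are group homomorphisms as in the following two rows and column, and both rows and the column are exact: $$SK_1(E_0)\longrightarrow \ker\widetilde N/[E_0^*,E^*]\xrightarrow{\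 \operatorname{Nrd}_{E_0}\ }\widehat H^{-1}\big(G,\operatorname{Nrd}_{E_0}(E_0^*)\big)\longrightarrow 1,$$ $$\Gamma_E/\Gamma_T\wedge\Gamma_E/\Gamma_T\longrightarrow E^{(1)}/[E_0^*,E^*]\longrightarrow SK_1(E)\longrightarrow 1,$$ $$1\longrightarrow \ker\widetilde N/[E_0^*,E^*]\longrightarrow E^{(1)}/[E_0^*,E^*]\xrightarrow{\ \widetilde N\ }\mu_\delta(T_0)\cap\widetilde N(E_0^*)\longrightarrow 1.$$ Here the first map of the first row and the first map $\ker\widetilde N/[E_0^*,E^*]\to E^{(1)}/[E_0^*,E^*]$ of the column are induced by inclusions, the maps labelled $\operatorname{Nrd}_{E_0}$ and $\widetilde N$ are induced by those maps, $E^{(1)}/[E_0^*,E^*]\to SK_1(E)$ is the canonical projection, and the first map of the second row sends $(\gamma+\Gamma_T)\wedge(\eta+\Gamma_T)$ to the class of $aba^{-1}b^{-1}$ for all units $a\in E_\gamma$, $b\in E_\eta$. -/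

import Mathlib

open scoped TensorProduct

universe u v

noncomputable section

/-! ### Reduced norm, index and reduced Whitehead group -/

/-- `f` is the reduced norm of `A` over its center `R`: after a faithfully flat base change
`R → S` and an isomorphism `S ⊗[R] A ≃ Mₙ(S)`, the element `f a` becomes `det (1 ⊗ a)`. -/
def IsReducedNorm (A : Type u) [Ring A] (f : A →* Subring.center A) : Prop :=
  ∃ (S : Type u) (_ : CommRing S) (_ : Algebra (Subring.center A) S)
    (_ : Module.FaithfullyFlat (Subring.center A) S) (n : ℕ)
    (φ : S ⊗[Subring.center A] A ≃ₐ[S] Matrix (Fin n) (Fin n) S),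
    ∀ a : A, (φ (1 ⊗ₜ[Subring.center A] a)).det = algebraMap (Subring.center A) S (f a)

open Classical in
/-- The reduced norm `Nrd_A : A → Z(A)` (the trivial map if `A` has no reduced norm). -/
def reducedNorm (A : Type u) [Ring A] : A →* Subring.center A :=
  if h : ∃ f : A →* Subring.center A, IsReducedNorm A f then h.choose else 1

/-- The reduced norm on units, `Nrd_A : A^* → Z(A)^*`. -/
def unitsNrd (A : Type u) [Ring A] : Aˣ →* (Subring.center A)ˣ :=
  Units.map (reducedNorm A)

/-- The index of `A`, that is, the square root of the rank of `A` over its center. -/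
def algIndex (A : Type u) [Ring A] : ℕ :=
  Nat.sqrt (Module.finrank (Subring.center A) A)

/-- The group `A^(1)` of elements of reduced norm `1` (such elements are units). -/
def normOne (A : Type u) [Ring A] : Subgroup Aˣ := (unitsNrd A).ker

/-- `SK₁(A) = A^(1) / [A^*, A^*]`. -/
abbrev SK1 (A : Type u) [Ring A] : Type u :=
  normOne A ⧸ (commutator Aˣ).subgroupOf (normOne A)

/-! ### Tate cohomology in degree `-1` -/

section Tate

variable (G : Type*) {M : Type*} [Group G] [Finite G] [CommGroup M] [MulDistribMulAction G M]

/-- The subgroup `A` of `M` is stable under `G`, so that it is itself a `G`-module. -/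
def IsStableSubgroup (G : Type*) {M : Type*} [Group G] [CommGroup M] [MulDistribMulAction G M]
    (A : Subgroup M) : Prop :=
  ∀ g : G, ∀ a ∈ A, g • a ∈ A

/-- For a `G`-stable subgroup `A` of `M`, the kernel of `N_G : A → A`, `a ↦ ∏ g • a`. -/
def tateKer (A : Subgroup M) : Subgroup M where
  carrier := {a | a ∈ A ∧ ∏ᶠ g : G, g • a = 1}
  one_mem' := ⟨A.one_mem, by simp⟩
  mul_mem' := by
    rintro a b ⟨ha, ha'⟩ ⟨hb, hb'⟩
    refine ⟨A.mul_mem ha hb, ?_⟩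
    simp only [smul_mul']
    rw [finprod_mul_distrib (Set.toFinite _) (Set.toFinite _), ha', hb', one_mul]
  inv_mem' := by
    rintro a ⟨ha, ha'⟩
    refine ⟨A.inv_mem ha, ?_⟩
    simp only [smul_inv']
    rw [finprod_inv_distrib, ha', inv_one]

/-- For a `G`-stable subgroup `A` of `M`, the subgroup `I_G(A)` of `A` generated by the elements
`a / (g • a)` with `a ∈ A` and `g ∈ G`. -/
def tateAug (A : Subgroup M) : Subgroup M :=
  Subgroup.closure {x | ∃ a ∈ A, ∃ g : G, x = a / g • a}

/-- `Ĥ⁻¹(G, A) = ker N_G / I_G(A)` for the `G`-module given by a `G`-stable subgroup `A` of the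
(multiplicative) `G`-module `M`. -/
abbrev TateHNegOne (A : Subgroup M) : Type _ :=
  tateKer G A ⧸ (tateAug G A).subgroupOf (tateKer G A)

end Tate

/-! ### Graded division rings -/

section Graded

variable {Γ : Type v} [AddCommGroup Γ] [DecidableEq Γ] {E : Type u} [Ring E]

/-- A graded ring is a graded division ring if it is nonzero and every nonzero homogeneous
element is invertible. (The grade group is torsion-free; this is a hypothesis on `Γ`.) -/
class IsGradedDivisionRing (𝒜 : Γ → AddSubgroup E) [GradedRing 𝒜] : Prop where
  nontrivial : Nontrivial E
  isUnit : ∀ γ : Γ, ∀ a ∈ 𝒜 γ, a ≠ 0 → IsUnit a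

variable (𝒜 : Γ → AddSubgroup E) [GradedRing 𝒜]

/-- The inverse of a homogeneous unit of degree `γ` is homogeneous of degree `-γ`. -/
theorem inv_mem_graded {γ : Γ} (w : Eˣ) (h : (w : E) ∈ 𝒜 γ) : ((w⁻¹ : Eˣ) : E) ∈ 𝒜 (-γ) := by
  have h1 : (DirectSum.decompose 𝒜 ((w : E) * ((w⁻¹ : Eˣ) : E)) (γ + -γ) : E)
      = (w : E) * (DirectSum.decompose 𝒜 ((w⁻¹ : Eˣ) : E) (-γ) : E) :=
    DirectSum.coe_decompose_mul_add_of_left_mem 𝒜 h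
  rw [Units.mul_inv, add_neg_cancel,
    DirectSum.decompose_of_mem_same 𝒜 SetLike.GradedOne.one_mem] at h1
  have h2 : ((w⁻¹ : Eˣ) : E) = (DirectSum.decompose 𝒜 ((w⁻¹ : Eˣ) : E) (-γ) : E) := by
    calc ((w⁻¹ : Eˣ) : E) = ((w⁻¹ : Eˣ) : E) * 1 := (mul_one _).symm
      _ = _ := by rw [h1, ← mul_assoc, Units.inv_mul, one_mul]
  rw [h2]
  exact SetLike.coe_mem _

theorem isUnit_of_graded [hE : IsGradedDivisionRing 𝒜] {γ : Γ} {a : E} (ha : a ∈ 𝒜 γ)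
    (h0 : a ≠ 0) : ∃ w : Eˣ, (w : E) = a ∧ ((w⁻¹ : Eˣ) : E) ∈ 𝒜 (-γ) := by
  obtain ⟨w, rfl⟩ := hE.isUnit γ a ha h0
  exact ⟨w, rfl, inv_mem_graded 𝒜 w ha⟩

/-- The group of degrees of the nonzero homogeneous elements of `E` that lie in a subring `S`
closed under inverses; it is used for `S = E` and for `S = Z(E)`. -/
def gradeGroupOf [hE : IsGradedDivisionRing 𝒜] (S : Subring E)
    (hS : ∀ w : Eˣ, (w : E) ∈ S → ((w⁻¹ : Eˣ) : E) ∈ S) : AddSubgroup Γ where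
  carrier := {γ | ∃ a ∈ 𝒜 γ, a ∈ S ∧ a ≠ 0}
  zero_mem' := by
    have := hE.nontrivial
    exact ⟨1, SetLike.GradedOne.one_mem, S.one_mem, one_ne_zero⟩
  add_mem' := by
    rintro γ δ ⟨a, ha, haS, ha0⟩ ⟨b, hb, hbS, hb0⟩
    obtain ⟨w, rfl, -⟩ := isUnit_of_graded 𝒜 ha ha0
    refine ⟨w * b, SetLike.GradedMul.mul_mem ha hb, S.mul_mem haS hbS, ?_⟩
    intro h
    exact hb0 (by simpa using h)
  neg_mem' := by
    have := hE.nontrivial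
    rintro γ ⟨a, ha, haS, ha0⟩
    obtain ⟨w, rfl, hw⟩ := isUnit_of_graded 𝒜 ha ha0
    exact ⟨_, hw, hS w haS, Units.ne_zero _⟩

theorem center_inv_mem (w : Eˣ) (h : (w : E) ∈ Subring.center E) :
    ((w⁻¹ : Eˣ) : E) ∈ Subring.center E := by
  rw [Subring.mem_center_iff] at h ⊢
  intro g
  have h1 : Commute g (w : E) := h g
  exact h1.units_inv_right

/-! ### The degree zero part -/

/-- The division ring `E₀`, as a subring of `E`. -/
abbrev degZero : Subring E := SetLike.GradeZero.subring 𝒜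

/-- The field `Z(E₀)`. -/
abbrev centerZero : Subring (degZero 𝒜) := Subring.center (degZero 𝒜)

/-- The field `T₀ = T ∩ E₀` for `T = Z(E)`, as a subring of `Z(E₀)`. -/
def baseZero : Subring (centerZero 𝒜) :=
  (Subring.center E).comap ((degZero 𝒜).subtype.comp (centerZero 𝒜).subtype)

/-- `G = Gal(Z(E₀)/T₀)`. -/
abbrev galZero : Type u := centerZero 𝒜 ≃ₐ[baseZero 𝒜] centerZero 𝒜

/-- `G` acts on `Z(E₀)^*` (through its action on `Z(E₀)`). -/
instance galZeroAction : MulDistribMulAction (galZero 𝒜) (centerZero 𝒜)ˣ :=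
  AlgEquiv.instMulDistribMulActionUnits

/-- `δ = ind(E) / (ind(E₀) [Z(E₀) : T₀])`. -/
def deltaE : ℕ :=
  algIndex E / (algIndex (degZero 𝒜) * Module.finrank (baseZero 𝒜) (centerZero 𝒜))

/-- The inclusion `E₀^* → E^*`. -/
def unitsIncl : (degZero 𝒜)ˣ →* Eˣ := Units.map (degZero 𝒜).subtype.toMonoidHom

/-- `Ñ = N_{Z(E₀)/T₀} ∘ Nrd_{E₀} : E₀^* → T₀^*`. -/
def tildeN : (degZero 𝒜)ˣ →* (baseZero 𝒜)ˣ :=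
  (Units.map (Algebra.norm (baseZero 𝒜))).comp (unitsNrd (degZero 𝒜))

/-- The group `Nrd_{E₀}(E₀^*)`, as a subgroup of `Z(E₀)^*`. -/
def nrdImage : Subgroup (centerZero 𝒜)ˣ := (unitsNrd (degZero 𝒜)).range

/-- `[E₀^*, E^*]`, the subgroup of `E^*` generated by the `a b a⁻¹ b⁻¹` with `a ∈ E₀^*` and
`b ∈ E^*`. -/
def mixedComm : Subgroup Eˣ := ⁅(unitsIncl 𝒜).range, (⊤ : Subgroup Eˣ)⁆

/-- Over a torsion-free grade group, the units of a graded division ring are homogeneous. -/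
theorem exists_mem_of_unit [IsAddTorsionFree Γ] [hE : IsGradedDivisionRing 𝒜] (w : Eˣ) :
    ∃ γ, (w : E) ∈ 𝒜 γ := by
  classical
  have := hE.nontrivial
  have : TwoUniqueSums Γ := TwoUniqueSums.of_injective_addHom
    (DivisibleHull.coeAddMonoidHom Γ).toAddHom DivisibleHull.coe_injective inferInstance
  set r := DirectSum.decompose 𝒜 (w : E) with hr
  set s := DirectSum.decompose 𝒜 ((w⁻¹ : Eˣ) : E) with hs
  have hrs : r * s = DirectSum.decompose 𝒜 (1 : E) := by
    rw [hr, hs, ← DirectSum.decompose_mul, Units.mul_inv]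
  have hr0 : r ≠ 0 := by
    intro h
    exact w.ne_zero ((DirectSum.decompose 𝒜).injective (by rw [← hr, h, DirectSum.decompose_zero]))
  have hs0 : s ≠ 0 := by
    intro h
    exact (w⁻¹).ne_zero
      ((DirectSum.decompose 𝒜).injective (by rw [← hs, h, DirectSum.decompose_zero]))
  have key : ∀ p ∈ r.support ×ˢ s.support,
      UniqueAdd r.support s.support p.1 p.2 → p.1 + p.2 = 0 := by
    intro p hp hu
    by_contra hne
    have h1 : ((r * s) (p.1 + p.2) : E) = r p.1 * s p.2 := by
      rw [DirectSum.coe_mul_apply, Finset.sum_eq_single p]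
      · intro q hq hqp
        rw [Finset.mem_filter, Finset.mem_product] at hq
        obtain ⟨h2, h3⟩ := hu hq.1.1 hq.1.2 hq.2
        exact absurd (Prod.ext h2 h3) hqp
      · intro h
        exact absurd (by simp only [Finset.mem_filter]; exact ⟨hp, trivial⟩) h
    rw [hrs, DirectSum.decompose_of_mem_ne 𝒜 SetLike.GradedOne.one_mem (Ne.symm hne)] at h1
    rw [Finset.mem_product, DFinsupp.mem_support_iff, DFinsupp.mem_support_iff] at hp
    have hu1 : IsUnit (r p.1 : E) := hE.isUnit _ _ (r p.1).2 (by simpa using hp.1)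
    have h4 : (s p.2 : E) = 0 := (hu1.mul_right_eq_zero).mp h1.symm
    exact hp.2 (by simpa using h4)
  have hcard : r.support.card ≤ 1 := by
    by_contra hlt
    have hspos : 0 < s.support.card := Finset.card_pos.mpr
      (Finset.nonempty_iff_ne_empty.mpr (by simpa [DFinsupp.support_eq_empty] using hs0))
    have h1 : 1 < r.support.card * s.support.card := by nlinarith
    obtain ⟨p, hp, q, hq, hpq, hup, huq⟩ := TwoUniqueSums.uniqueAdd_of_one_lt_card h1
    have hp0 := key p hp hup
    have hq0 := key q hq huq
    rw [Finset.mem_product] at hq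
    obtain ⟨h2, h3⟩ := hup hq.1 hq.2 (hq0.trans hp0.symm)
    exact hpq (Prod.ext h2 h3).symm
  obtain ⟨γ, hγ⟩ := Finset.nonempty_iff_ne_empty.mpr
    (show r.support ≠ ∅ by simpa [DFinsupp.support_eq_empty] using hr0)
  refine ⟨γ, ?_⟩
  have hsum := DirectSum.sum_support_decompose 𝒜 (w : E)
  rw [← hr, Finset.sum_eq_single γ] at hsum
  · rw [← hsum]
    exact (r γ).2
  · intro b hb hbγ
    exact absurd (Finset.card_le_one.mp hcard b hb γ hγ) hbγ
  · intro h
    exact absurd hγ h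

theorem mem_range_unitsIncl (w : Eˣ) : w ∈ (unitsIncl 𝒜).range ↔ (w : E) ∈ 𝒜 0 := by
  constructor
  · rintro ⟨x, rfl⟩
    exact x.1.2
  · intro h
    have h' : ((w⁻¹ : Eˣ) : E) ∈ 𝒜 0 := by
      have := inv_mem_graded 𝒜 w h
      rwa [neg_zero] at this
    exact ⟨⟨⟨w, h⟩, ⟨_, h'⟩, Subtype.ext w.mul_inv, Subtype.ext w.inv_mul⟩, Units.ext rfl⟩

instance range_unitsIncl_normal [IsAddTorsionFree Γ] [IsGradedDivisionRing 𝒜] :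
    (unitsIncl 𝒜).range.Normal where
  conj_mem := by
    intro x hx g
    rw [mem_range_unitsIncl] at hx ⊢
    obtain ⟨γ, hγ⟩ := exists_mem_of_unit 𝒜 g
    have h := SetLike.GradedMul.mul_mem (SetLike.GradedMul.mul_mem hγ hx)
      (inv_mem_graded 𝒜 g hγ)
    rwa [add_zero, add_neg_cancel] at h

instance mixedComm_normal [IsAddTorsionFree Γ] [IsGradedDivisionRing 𝒜] :
    (mixedComm 𝒜).Normal :=
  Subgroup.commutator_normal _ _

/-- `[E₀^*, E^*]` as a subgroup of `E₀^*`. -/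
def mixedCommZero : Subgroup (degZero 𝒜)ˣ := (mixedComm 𝒜).comap (unitsIncl 𝒜)

instance mixedCommZero_normal [IsAddTorsionFree Γ] [IsGradedDivisionRing 𝒜] :
    (mixedCommZero 𝒜).Normal :=
  Subgroup.normal_comap _

/-- The group `ker Ñ / [E₀^*, E^*]`. -/
abbrev KerNQuot : Type u :=
  (tildeN 𝒜).ker ⧸ (mixedCommZero 𝒜).subgroupOf (tildeN 𝒜).ker

/-- The group `E^(1) / [E₀^*, E^*]`. -/
abbrev NormOneQuot : Type u :=
  normOne E ⧸ (mixedComm 𝒜).subgroupOf (normOne E)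

/-- The group `μ_δ(T₀) ∩ Ñ(E₀^*)`. -/
def muImage : Subgroup (baseZero 𝒜)ˣ := rootsOfUnity (deltaE 𝒜) (baseZero 𝒜) ⊓ (tildeN 𝒜).range

/-! ### Grade groups -/

variable [IsGradedDivisionRing 𝒜]

/-- The grade group `Γ_E`. -/
def gradeGroup : AddSubgroup Γ := gradeGroupOf 𝒜 ⊤ (fun _ _ => Subring.mem_top _)

/-- The grade group `Γ_T` of the center `T` of `E`. -/
def gradeGroupCenter : AddSubgroup Γ := gradeGroupOf 𝒜 (Subring.center E) center_inv_mem

/-- The quotient `Γ_E / Γ_T`. -/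
abbrev GradeQuot : Type v := gradeGroup 𝒜 ⧸ (gradeGroupCenter 𝒜).addSubgroupOf (gradeGroup 𝒜)

end Graded

end

/-!
Let `T` be the center of the graded division ring `E`.

*Splitting.* A maximal set of pairwise commuting homogeneous elements generates a commutative graded
subring `L`, which is its own centralizer (`MaxCommHomog`); both `E` over `L` and `L` over `T` are
free. Right multiplications by `E` are `L`-linear and give a map `L ⊗_T E → Mₙ(L)`, `n = [E : L]`. A
shortest relation between homogeneous elements could be shortened further
(`eq_zero_of_bimodule_relation`); hence this map is injective, so that `[E : T] ≤ n²`, and similarly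
`n ≤ [L : T]`. It follows that `[E : T] = n²` and `[L : T] = n`, and the determinant of the map in
homogeneous bases is a nonzero homogeneous element, that is, a unit
(`MaxCommHomog.exists_splitting`).

*Descent.* An `S`-algebra endomorphism of `Mₙ(S)` preserves determinants
(`Matrix.det_algHom_apply`). So the determinant of an element `1 ⊗ a` has equal images under both
maps `L → L ⊗_T L`, and it lies in `T` by faithfully flat descent (`det_splitting_mem_range`).
The same comparison over the tensor product of two splitting rings shows that the reduced norm is
unique. As `E₀` is a graded division
ring for the trivial grading, all this applies to it as well.

*Comparison of norms.* On `L` the reduced norm is `N_{L/T}`: the `n`-th powers of the two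
characteristic polynomials agree, since both are that of left multiplication on `E`, and monic
polynomials over the domain `L` with equal powers are equal (`MaxCommHomog.reducedNorm_eq_norm`).
Torsion-freeness of `Γ` is what makes `E`, and so `L`, a domain. If `L` contains a maximal subfield
`L₀` of `E₀`, then a basis of `L₀` over `T₀` times representatives of `Γ_L / Γ_T` is a basis of `L`
over `T`, which gives `Nrd_E = Ñ ^ δ` on `E₀` (`reducedNorm_degZero`). On `T` the reduced norm is
the `ind(E)`-th power, and `Γ_E / Γ_T` is torsion, so an element of reduced norm `1` has degree `0`
(`normOne_le_range`).

*Galois action.* The units of `E` are homogeneous, and by conjugation they act on `Z(E₀)` with fixed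
ring `T₀`. By Galois theory every element of `G` is therefore conjugation by a unit
(`conjGal_surjective`). The reduced norm of `E₀` commutes with automorphisms, so `Nrd_{E₀}(E₀^*)` is
stable under `G`, and `Nrd_{E₀}` maps `[E₀^*, E^*]` onto `I_G(Nrd_{E₀}(E₀^*))` (`tateAug_eq_map`).

*The diagram.* Since `[E^*, E^*] ⊆ E₀^*`, commutators are central modulo `[E₀^*, E^*]`, so they
define an alternating pairing on `Γ_E / Γ_T` (`exists_commutator_map`). Its image generates
`[E^*, E^*]` modulo `[E₀^*, E^*]`, which is exactness of the lower row. The upper row is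
exact by the description of `I_G(Nrd_{E₀}(E₀^*))`, and the column because `x ∈ E₀^*` has `Nrd_E(x) = Ñ(x) ^ δ`.
-/

noncomputable section

/-! ### Determinants under algebra homomorphisms of matrix rings -/

open Matrix in
/-- The matrix with columns `ψ (single i k 1) v`; it intertwines `ψ` with the identity. -/
def Matrix.intertwiner {S n : Type*} [CommRing S] [Fintype n] [DecidableEq n]
    (ψ : Matrix n n S →ₐ[S] Matrix n n S) (k : n) (v : n → S) : Matrix n n S :=
  Matrix.of fun j i => (ψ (Matrix.single i k 1) *ᵥ v) j

open Matrix in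
theorem Matrix.mul_intertwiner {S n : Type*} [CommRing S] [Fintype n] [DecidableEq n]
    (ψ : Matrix n n S →ₐ[S] Matrix n n S) (k : n) (v : n → S) (M : Matrix n n S) :
    ψ M * intertwiner ψ k v = intertwiner ψ k v * M := by
  ext j i
  have h1 : M * Matrix.single i k 1 = ∑ l, M l i • Matrix.single l k (1 : S) := by
    ext a b
    simp only [Matrix.sum_apply, Matrix.smul_apply, Matrix.single_apply, Matrix.mul_apply]
    by_cases hb : k = b <;> simp [hb]
  have h2 : (ψ M * intertwiner ψ k v) j i = ((ψ (M * Matrix.single i k 1)) *ᵥ v) j := by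
    rw [map_mul, ← Matrix.mulVec_mulVec]
    rfl
  rw [h2, h1, map_sum, Matrix.sum_mulVec]
  simp only [map_smul, Matrix.smul_mulVec, Finset.sum_apply, Pi.smul_apply, smul_eq_mul,
    Matrix.mul_apply, intertwiner, Matrix.of_apply, mul_comm]

open Matrix in
/-- Algebra endomorphisms of a matrix ring over a commutative ring preserve the determinant.
The determinants of the intertwiners generate the unit ideal, because modulo a maximal ideal a
vector not killed by `ψ (single k k 1)` gives an invertible intertwiner. -/
theorem Matrix.det_algHom_apply {S n : Type*} [CommRing S] [Fintype n] [DecidableEq n]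
    (ψ : Matrix n n S →ₐ[S] Matrix n n S) (M : Matrix n n S) : (ψ M).det = M.det := by
  classical
  cases isEmpty_or_nonempty n
  · simp
  obtain ⟨k⟩ := ‹Nonempty n›
  have key : ∀ v, ((ψ M).det - M.det) * (intertwiner ψ k v).det = 0 := by
    intro v
    have := congrArg Matrix.det (mul_intertwiner ψ k v M)
    rw [Matrix.det_mul, Matrix.det_mul] at this
    linear_combination this
  set I : Ideal S := Ideal.span (Set.range fun v => (intertwiner ψ k v).det) with hI
  have hIann : ∀ x ∈ I, ((ψ M).det - M.det) * x = 0 := by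
    intro x hx
    refine Submodule.span_induction ?_ (by simp) ?_ ?_ hx
    · rintro _ ⟨v, rfl⟩
      exact key v
    · intro x y _ _ hx hy
      rw [mul_add, hx, hy, add_zero]
    · intro a x _ hx
      rw [smul_eq_mul, mul_left_comm, hx, mul_zero]
  have htop : I = ⊤ := by
    by_contra hne
    obtain ⟨m, hm, hIm⟩ := Ideal.exists_le_maximal I hne
    let := Ideal.Quotient.field m
    let q := Ideal.Quotient.mk m
    let B : n → n → Matrix n n S := fun i j => ψ (Matrix.single i j 1)
    have hB : ∀ i j l, B i j * B j l = B i l := by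
      intro i j l
      simp only [B, ← map_mul, Matrix.single_mul_single_same, mul_one]
    have hB0 : ∀ i j j' l, j ≠ j' → B i j * B j' l = 0 := by
      intro i j j' l h
      simp only [B, ← map_mul]
      rw [Matrix.single_mul_single_of_ne _ _ _ _ h, map_zero]
    -- some vector is not killed by the idempotent modulo `m`
    have hkk : (B k k).map q ≠ 0 := by
      intro h0
      have hall : ∀ i, (B i i).map q = 0 := by
        intro i
        rw [← hB i k i, ← hB i k k, Matrix.map_mul, Matrix.map_mul, h0, mul_zero, zero_mul]
      have h1 : ∑ i, B i i = 1 := by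
        simp only [B, ← map_sum]
        rw [Matrix.sum_single_one, map_one]
      have h2 : (1 : Matrix n n (S ⧸ m)) = 0 := by
        have := congrArg (fun X : Matrix n n S => q.mapMatrix X) h1
        simp only [map_sum, map_one] at this
        rw [← this]
        exact Finset.sum_eq_zero fun i _ => hall i
      exact one_ne_zero (congrFun (congrFun h2 k) k |>.symm.trans (Matrix.one_apply_eq k)).symm
    obtain ⟨v', hv'⟩ : ∃ v', (B k k).map q *ᵥ v' ≠ 0 := by
      by_contra! h
      exact hkk (Matrix.ext_of_mulVec_single fun i => by rw [h, Matrix.zero_mulVec])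
    obtain ⟨v, rfl⟩ : ∃ v : n → S, q ∘ v = v' :=
      ⟨fun i => (Ideal.Quotient.mk_surjective (v' i)).choose,
        funext fun i => (Ideal.Quotient.mk_surjective (v' i)).choose_spec⟩
    have hmem : (intertwiner ψ k v).det ∈ m := hIm (Ideal.subset_span ⟨v, rfl⟩)
    have hdet : ((intertwiner ψ k v).map q).det = 0 := by
      rw [← RingHom.mapMatrix_apply, ← RingHom.map_det]
      exact Ideal.Quotient.eq_zero_iff_mem.mpr hmem
    obtain ⟨c, hc0, hc⟩ := Matrix.exists_mulVec_eq_zero_iff.mpr hdet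
    have hcol : ((intertwiner ψ k v).map q) *ᵥ c = ∑ i, c i • ((B i k).map q *ᵥ (q ∘ v)) := by
      ext j
      simp only [Matrix.mulVec, dotProduct, Matrix.map_apply, intertwiner, Matrix.of_apply,
        map_sum, map_mul, Finset.sum_apply, Pi.smul_apply, smul_eq_mul, Function.comp_apply, B]
      exact Finset.sum_congr rfl fun i _ => mul_comm _ _
    apply hc0
    funext j
    have h3 : (B k j).map q *ᵥ (((intertwiner ψ k v).map q) *ᵥ c)
        = c j • ((B k k).map q *ᵥ (q ∘ v)) := by
      rw [hcol, Matrix.mulVec_sum, Finset.sum_eq_single j]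
      · rw [Matrix.mulVec_smul, Matrix.mulVec_mulVec, ← Matrix.map_mul, hB]
      · intro i _ hij
        rw [Matrix.mulVec_smul, Matrix.mulVec_mulVec, ← Matrix.map_mul, hB0 _ _ _ _ hij.symm]
        simp
      · simp
    rw [hc, Matrix.mulVec_zero] at h3
    exact (smul_eq_zero.mp h3.symm).resolve_right hv'
  have h1 := hIann 1 (by rw [htop]; trivial)
  rw [mul_one] at h1
  exact sub_eq_zero.mp h1

/-! ### Existence and uniqueness of reduced norms -/

section ReducedNorm

variable {R A : Type*} [CommRing R] [Ring A] [Algebra R A]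

/-- Two matrix splittings over the same ring give the same determinants. -/
theorem det_splitting_eq {S : Type*} [CommRing S] [Algebra R S] {n m : ℕ}
    (φ : S ⊗[R] A ≃ₐ[S] Matrix (Fin n) (Fin n) S) (χ : S ⊗[R] A ≃ₐ[S] Matrix (Fin m) (Fin m) S)
    (x : S ⊗[R] A) : (φ x).det = (χ x).det := by
  nontriviality S
  have hnm : n = m := by
    have h := (φ.symm.trans χ).toLinearEquiv.finrank_eq
    simp only [Module.finrank_matrix, Module.finrank_self, mul_one, Fintype.card_fin] at h
    exact Nat.mul_self_inj.mp h
  subst hnm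
  have h := Matrix.det_algHom_apply (χ.symm.trans φ : _ →ₐ[S] _) (χ x)
  simpa using h

/-- Base change of a matrix splitting. -/
theorem exists_splitting_baseChange {S S' : Type*} [CommRing S] [Algebra R S] [CommRing S']
    [Algebra R S'] (i : S →ₐ[R] S') {n : ℕ} (φ : S ⊗[R] A ≃ₐ[S] Matrix (Fin n) (Fin n) S) :
    ∃ φ' : S' ⊗[R] A ≃ₐ[S'] Matrix (Fin n) (Fin n) S',
      ∀ a, φ' (1 ⊗ₜ a) = (φ (1 ⊗ₜ a)).map i := by
  let : Algebra S S' := i.toRingHom.toAlgebra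
  have : IsScalarTower R S S' := IsScalarTower.of_algebraMap_eq' i.comp_algebraMap.symm
  let e₁ : S' ⊗[R] A ≃ₐ[S'] S' ⊗[S] (S ⊗[R] A) :=
    Algebra.TensorProduct.algEquivOfLinearEquivTensorProduct
      (TensorProduct.AlgebraTensorModule.cancelBaseChange R S S' S' A).symm
      (by intros; simp [Algebra.TensorProduct.tmul_mul_tmul])
      (by simp [Algebra.TensorProduct.one_def])
  let e₂ : S' ⊗[S] (S ⊗[R] A) ≃ₐ[S'] S' ⊗[S] Matrix (Fin n) (Fin n) S :=
    Algebra.TensorProduct.congr AlgEquiv.refl φ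
  let e₃ : S' ⊗[S] Matrix (Fin n) (Fin n) S ≃ₐ[S'] Matrix (Fin n) (Fin n) S' :=
    AlgEquiv.ofRingEquiv (f := (matrixEquivTensor (Fin n) S S').symm.toRingEquiv) (by
      intro r
      change (matrixEquivTensor (Fin n) S S').symm (r ⊗ₜ 1) = _
      rw [matrixEquivTensor_apply_symm]
      ext a b
      by_cases h : a = b <;> simp [Matrix.algebraMap_matrix_apply, h])
  refine ⟨(e₁.trans e₂).trans e₃, fun a => ?_⟩
  change (matrixEquivTensor (Fin n) S S').symm (e₂ (e₁ (1 ⊗ₜ a))) = _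
  have h1 : e₁ (1 ⊗ₜ a) = 1 ⊗ₜ (1 ⊗ₜ a) :=
    TensorProduct.AlgebraTensorModule.cancelBaseChange_symm_tmul ..
  rw [h1]
  have h2 : e₂ (1 ⊗ₜ (1 ⊗ₜ a)) = 1 ⊗ₜ φ (1 ⊗ₜ a) := by simp [e₂]
  rw [h2, matrixEquivTensor_apply_symm]
  ext j l
  simp
  rfl

/-- The determinants of a splitting over a faithfully flat base change come from the base, by
descent along the two maps `S → S ⊗ S`. -/
theorem det_splitting_mem_range {S : Type*} [CommRing S] [Algebra R S]
    [Module.FaithfullyFlat R S] {n : ℕ} (φ : S ⊗[R] A ≃ₐ[S] Matrix (Fin n) (Fin n) S) (a : A) :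
    (φ (1 ⊗ₜ a)).det ∈ Set.range (algebraMap R S) := by
  rw [← Algebra.IsEffective.eqLocus_includeLeft_includeRight
    (Algebra.IsEffective.of_faithfullyFlat R S)]
  let i₁ : S →ₐ[R] S ⊗[R] S := Algebra.TensorProduct.includeLeft
  let i₂ : S →ₐ[R] S ⊗[R] S := Algebra.TensorProduct.includeRight
  change i₁ _ = i₂ _
  obtain ⟨φ₁, h₁⟩ := exists_splitting_baseChange i₁ φ
  obtain ⟨φ₂, h₂⟩ := exists_splitting_baseChange i₂ φ
  have h := det_splitting_eq φ₁ φ₂ (1 ⊗ₜ a)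
  rw [h₁, h₂] at h
  rw [AlgHom.map_det, AlgHom.map_det]
  exact h

end ReducedNorm

section

variable (A : Type u) [Ring A]

theorem IsReducedNorm.unique {f g : A →* Subring.center A} (hf : IsReducedNorm A f)
    (hg : IsReducedNorm A g) : f = g := by
  obtain ⟨S, _, _, _, n, φ, hφ⟩ := hf
  obtain ⟨S', _, _, _, n', φ', hφ'⟩ := hg
  ext1 a
  let i₁ : S →ₐ[Subring.center A] S ⊗[Subring.center A] S' := Algebra.TensorProduct.includeLeft
  let i₂ : S' →ₐ[Subring.center A] S ⊗[Subring.center A] S' := Algebra.TensorProduct.includeRight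
  obtain ⟨φ₁, h₁⟩ := exists_splitting_baseChange i₁ φ
  obtain ⟨φ₂, h₂⟩ := exists_splitting_baseChange i₂ φ'
  have h := det_splitting_eq φ₁ φ₂ (1 ⊗ₜ a)
  rw [h₁, h₂] at h
  have e₁ : ((φ (1 ⊗ₜ a)).map i₁).det = i₁ (φ (1 ⊗ₜ a)).det := (AlgHom.map_det i₁ _).symm
  have e₂ : ((φ' (1 ⊗ₜ a)).map i₂).det = i₂ (φ' (1 ⊗ₜ a)).det := (AlgHom.map_det i₂ _).symm
  rw [e₁, e₂, hφ, hφ', AlgHom.commutes, AlgHom.commutes] at h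
  have : Module.FaithfullyFlat (Subring.center A) (S ⊗[Subring.center A] S') :=
    Module.FaithfullyFlat.trans (Subring.center A) S _
  exact FaithfulSMul.algebraMap_injective _ (S ⊗[Subring.center A] S') h

/-- The determinants of a splitting over a faithfully flat base change define a multiplicative
map to the center. -/
theorem exists_monoidHom_det_splitting {S : Type u} [CommRing S] [Algebra (Subring.center A) S]
    [Module.FaithfullyFlat (Subring.center A) S] {n : ℕ}
    (φ : S ⊗[Subring.center A] A ≃ₐ[S] Matrix (Fin n) (Fin n) S) :
    ∃ f : A →* Subring.center A, ∀ a, algebraMap _ S (f a) = (φ (1 ⊗ₜ a)).det := by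
  have hinj : Function.Injective (algebraMap (Subring.center A) S) :=
    FaithfulSMul.algebraMap_injective _ _
  choose f hf using fun a => det_splitting_mem_range φ a
  refine ⟨{ toFun := f, map_one' := hinj ?_, map_mul' := fun a b => hinj ?_ }, hf⟩
  · rw [hf, map_one, ← Algebra.TensorProduct.one_def, map_one, Matrix.det_one]
  · rw [hf, map_mul, hf, hf, ← Matrix.det_mul, ← map_mul, Algebra.TensorProduct.tmul_mul_tmul,
      one_mul]

theorem existsUnique_isReducedNorm {S : Type u} [CommRing S] [Algebra (Subring.center A) S]
    [Module.FaithfullyFlat (Subring.center A) S] {n : ℕ}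
    (φ : S ⊗[Subring.center A] A ≃ₐ[S] Matrix (Fin n) (Fin n) S) :
    ∃! f : A →* Subring.center A, IsReducedNorm A f := by
  obtain ⟨f, hf⟩ := exists_monoidHom_det_splitting A φ
  have h : IsReducedNorm A f := ⟨S, _, _, ‹_›, n, φ, fun a => (hf a).symm⟩
  exact ⟨f, h, fun g hg => IsReducedNorm.unique A hg h⟩

theorem isReducedNorm_reducedNorm (h : ∃! f : A →* Subring.center A, IsReducedNorm A f) :
    IsReducedNorm A (reducedNorm A) := by
  have h' := h.exists
  rw [reducedNorm, dif_pos h']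
  exact h'.choose_spec

/-- Every splitting over a faithfully flat base change computes the reduced norm. -/
theorem algebraMap_reducedNorm {S : Type u} [CommRing S] [Algebra (Subring.center A) S]
    [Module.FaithfullyFlat (Subring.center A) S] {n : ℕ}
    (φ : S ⊗[Subring.center A] A ≃ₐ[S] Matrix (Fin n) (Fin n) S) (a : A) :
    algebraMap _ S (reducedNorm A a) = (φ (1 ⊗ₜ a)).det := by
  obtain ⟨f, hf⟩ := exists_monoidHom_det_splitting A φ
  have h : IsReducedNorm A f := ⟨S, _, _, ‹_›, n, φ, fun a => (hf a).symm⟩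
  rw [IsReducedNorm.unique A (isReducedNorm_reducedNorm A (existsUnique_isReducedNorm A φ)) h]
  exact hf a

theorem commutator_le_normOne : commutator Aˣ ≤ normOne A :=
  Abelianization.commutator_subset_ker _

end

/-! ### Characteristic polynomials of block diagonal maps -/

open Polynomial in
/-- A monic polynomial over a domain is determined by any of its positive powers. -/
theorem Polynomial.Monic.eq_of_pow_eq_pow {S : Type*} [CommRing S] [IsDomain S] {P Q : S[X]}
    (hP : P.Monic) (hQ : Q.Monic) {n : ℕ} (hn : n ≠ 0) (h : P ^ n = Q ^ n) : P = Q := by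
  let K := FractionRing S
  have hinj : Function.Injective (Polynomial.map (algebraMap S K)) :=
    Polynomial.map_injective _ (IsFractionRing.injective S K)
  apply hinj
  have h' : (P.map (algebraMap S K)) ^ n = (Q.map (algebraMap S K)) ^ n := by
    rw [← Polynomial.map_pow, h, Polynomial.map_pow]
  exact Polynomial.eq_of_monic_of_associated (hP.map _) (hQ.map _)
    (associated_of_dvd_dvd
      ((IsIntegrallyClosed.pow_dvd_pow_iff hn).mp h'.dvd)
      ((IsIntegrallyClosed.pow_dvd_pow_iff hn).mp h'.symm.dvd))

section Blocks

variable {R V ι κ : Type*} [CommRing R] [AddCommGroup V] [Module R V] [Fintype ι] [DecidableEq ι]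
  [Fintype κ] [DecidableEq κ]

theorem Matrix.charmatrix_blockDiagonal (M : κ → Matrix ι ι R) :
    (blockDiagonal M).charmatrix = blockDiagonal fun k => (M k).charmatrix := by
  ext1 ⟨i, k⟩ ⟨j, l⟩
  by_cases hkl : k = l
  · subst hkl
    by_cases hij : i = j
    · subst hij
      simp [Matrix.charmatrix_apply_eq, Matrix.blockDiagonal_apply]
    · rw [Matrix.charmatrix_apply_ne _ _ _ (by simpa using hij)]
      simp [Matrix.blockDiagonal_apply, Matrix.charmatrix_apply_ne _ _ _ hij]
  · rw [Matrix.charmatrix_apply_ne _ _ _ (by simp [hkl])]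
    simp [Matrix.blockDiagonal_apply, hkl]

theorem LinearMap.toMatrix_eq_blockDiagonal (b : Module.Basis (ι × κ) R V) (f : V →ₗ[R] V)
    (A : Matrix ι ι R) (h : ∀ i k, f (b (i, k)) = ∑ i', A i' i • b (i', k)) :
    LinearMap.toMatrix b b f = Matrix.blockDiagonal fun _ => A := by
  ext ⟨i, k⟩ ⟨j, l⟩
  rw [LinearMap.toMatrix_apply, h, map_sum, Finsupp.finsetSum_apply, Matrix.blockDiagonal_apply,
    Finset.sum_eq_single i]
  · by_cases hkl : k = l <;> simp [hkl]
  · intro i' _ hi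
    simp [hi]
  · simp

theorem LinearMap.det_eq_pow_of_blocks (b : Module.Basis (ι × κ) R V) (f : V →ₗ[R] V)
    (A : Matrix ι ι R) (h : ∀ i k, f (b (i, k)) = ∑ i', A i' i • b (i', k)) :
    LinearMap.det f = A.det ^ Fintype.card κ := by
  rw [← LinearMap.det_toMatrix b, LinearMap.toMatrix_eq_blockDiagonal b f A h,
    Matrix.det_blockDiagonal, Finset.prod_const, Finset.card_univ]

theorem LinearMap.charpoly_eq_pow_of_blocks [Module.Finite R V] [Module.Free R V]
    (b : Module.Basis (ι × κ) R V) (f : V →ₗ[R] V)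
    (A : Matrix ι ι R) (h : ∀ i k, f (b (i, k)) = ∑ i', A i' i • b (i', k)) :
    f.charpoly = A.charpoly ^ Fintype.card κ := by
  rw [← LinearMap.charpoly_toMatrix f b, LinearMap.toMatrix_eq_blockDiagonal b f A h,
    Matrix.charpoly, Matrix.charmatrix_blockDiagonal, Matrix.det_blockDiagonal, Finset.prod_const,
    Finset.card_univ]
  rfl

theorem Matrix.charpoly_lmul (A : Matrix ι ι R) :
    (Algebra.lmul R (Matrix ι ι R) A).charpoly = A.charpoly ^ Fintype.card ι := by
  refine LinearMap.charpoly_eq_pow_of_blocks (Matrix.stdBasis R ι ι) _ A fun i k => ?_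
  ext a c
  simp only [Matrix.stdBasis_eq_single, Algebra.coe_lmul_eq_mul, LinearMap.mul_apply',
    Matrix.sum_apply, Matrix.smul_apply, Matrix.single_apply, Matrix.mul_apply]
  by_cases hc : k = c <;> simp [hc]

end Blocks

/-- If `x` lies in a commutative subalgebra `L`, and `E` is free over `L`, then the characteristic
polynomial of left multiplication by `x` on `E` is a power of that on `L`. -/
theorem charpoly_lmul_of_tower {R L E κ : Type*} [CommRing R] [CommRing L] [Ring E]
    [Algebra R L] [Algebra R E] [Module L E] [IsScalarTower R L E] [IsScalarTower L E E]
    [Module.Free R L] [Module.Finite R L] [Module.Free R E] [Module.Finite R E]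
    [Fintype κ] (b : Module.Basis κ L E) (x : L) :
    (Algebra.lmul R E (x • 1)).charpoly = (Algebra.lmul R L x).charpoly ^ Fintype.card κ := by
  classical
  nontriviality R
  let c := Module.Free.chooseBasis R L
  rw [← LinearMap.charpoly_toMatrix (Algebra.lmul R L x) c]
  refine LinearMap.charpoly_eq_pow_of_blocks (c.smulTower b) _ _ fun i k => ?_
  simp only [Module.Basis.smulTower_apply, Algebra.coe_lmul_eq_mul, LinearMap.mul_apply',
    smul_mul_assoc, one_mul]
  rw [smul_smul]
  have : x * c i = ∑ i', (LinearMap.toMatrix c c (Algebra.lmul R L x)) i' i • c i' := by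
    conv_lhs => rw [← c.sum_repr (x * c i)]
    simp [LinearMap.toMatrix_apply]
  rw [this, Finset.sum_smul]
  simp [smul_assoc, LinearMap.toMatrix_apply]

/-! ### Homogeneous components -/

section GradedBasics

variable {Γ : Type v} [AddCommGroup Γ] [DecidableEq Γ] {E : Type u} [Ring E]
variable (𝒜 : Γ → AddSubgroup E) [GradedRing 𝒜]

theorem proj_same {γ : Γ} {x : E} (hx : x ∈ 𝒜 γ) : GradedRing.proj 𝒜 γ x = x := by
  rw [GradedRing.proj_apply, DirectSum.decompose_of_mem_same 𝒜 hx]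

theorem proj_ne {γ δ : Γ} {x : E} (hx : x ∈ 𝒜 γ) (h : γ ≠ δ) : GradedRing.proj 𝒜 δ x = 0 := by
  rw [GradedRing.proj_apply, DirectSum.decompose_of_mem_ne 𝒜 hx h]

theorem proj_mem (γ : Γ) (x : E) : GradedRing.proj 𝒜 γ x ∈ 𝒜 γ := by
  rw [GradedRing.proj_apply]
  exact SetLike.coe_mem _

theorem proj_mul_right {γ β : Γ} (x : E) {b : E} (hb : b ∈ 𝒜 β) :
    GradedRing.proj 𝒜 γ (x * b) = GradedRing.proj 𝒜 (γ - β) x * b := by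
  have := DirectSum.coe_decompose_mul_add_of_right_mem (a := x) (i := γ - β) 𝒜 hb
  rwa [sub_add_cancel] at this

theorem proj_mul_left {γ α : Γ} {a : E} (x : E) (ha : a ∈ 𝒜 α) :
    GradedRing.proj 𝒜 γ (a * x) = a * GradedRing.proj 𝒜 (γ - α) x := by
  have := DirectSum.coe_decompose_mul_add_of_left_mem (b := x) (j := γ - α) 𝒜 ha
  rwa [add_sub_cancel] at this

/-- An additive subgroup containing all components of `x` contains `x`. -/
theorem mem_of_proj_mem {V : AddSubgroup E} {x : E} (h : ∀ γ, GradedRing.proj 𝒜 γ x ∈ V) :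
    x ∈ V := by
  classical
  rw [← DirectSum.sum_support_decompose 𝒜 x]
  exact V.sum_mem fun γ _ => h γ

theorem eq_of_proj_eq {x y : E} (h : ∀ γ, GradedRing.proj 𝒜 γ x = GradedRing.proj 𝒜 γ y) :
    x = y := by
  rw [← sub_eq_zero, ← AddSubgroup.mem_bot]
  refine mem_of_proj_mem 𝒜 fun γ => ?_
  rw [map_sub, h, sub_self]
  exact zero_mem _

theorem exists_proj_ne_zero {x : E} (hx : x ≠ 0) : ∃ γ, GradedRing.proj 𝒜 γ x ≠ 0 := by
  by_contra! h
  exact hx (eq_of_proj_eq 𝒜 fun γ => by rw [h, map_zero])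

theorem commute_proj {x b : E} {β : Γ} (hb : b ∈ 𝒜 β) (h : b * x = x * b) (γ : Γ) :
    b * GradedRing.proj 𝒜 γ x = GradedRing.proj 𝒜 γ x * b := by
  have := congrArg (GradedRing.proj 𝒜 (γ + β)) h
  rwa [proj_mul_left 𝒜 x hb, proj_mul_right 𝒜 x hb, add_sub_cancel_right] at this

theorem commute_of_commute_homogeneous {x : E} (h : ∀ γ, ∀ b ∈ 𝒜 γ, b * x = x * b) (y : E) :
    y * x = x * y := by
  let V : AddSubgroup E :=
    { carrier := {y | y * x = x * y}
      zero_mem' := by simp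
      add_mem' := fun {a b} ha hb => by
        simp only [Set.mem_ofPred_eq] at *
        rw [add_mul, mul_add, ha, hb]
      neg_mem' := fun {a} ha => by
        simp only [Set.mem_ofPred_eq] at *
        rw [neg_mul, mul_neg, ha] }
  exact mem_of_proj_mem 𝒜 (V := V) fun γ => h γ _ (proj_mem 𝒜 γ y)

theorem proj_mem_center {x : E} (hx : x ∈ Subring.center E) (γ : Γ) :
    GradedRing.proj 𝒜 γ x ∈ Subring.center E := by
  rw [Subring.mem_center_iff] at hx ⊢
  exact commute_of_commute_homogeneous 𝒜 fun β b hb => commute_proj 𝒜 hb (hx b) γ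

variable [hE : IsGradedDivisionRing 𝒜]

include hE in
theorem isDomain_of_isGradedDivisionRing [IsAddTorsionFree Γ] : IsDomain E := by
  classical
  have := hE.nontrivial
  have : TwoUniqueSums Γ := TwoUniqueSums.of_injective_addHom
    (DivisibleHull.coeAddMonoidHom Γ).toAddHom DivisibleHull.coe_injective inferInstance
  have : NoZeroDivisors E := by
    refine ⟨fun {a b} hab => ?_⟩
    by_contra! hne
    set r := DirectSum.decompose 𝒜 a with hr
    set s := DirectSum.decompose 𝒜 b with hs
    have hrs : r * s = 0 := by
      rw [hr, hs, ← DirectSum.decompose_mul, hab, DirectSum.decompose_zero]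
    have hr0 : r.support.Nonempty := by
      rw [Finset.nonempty_iff_ne_empty, Ne, DFinsupp.support_eq_empty, hr]
      exact fun h => hne.1 ((DirectSum.decompose 𝒜).injective
        (h.trans (DirectSum.decompose_zero 𝒜).symm))
    have hs0 : s.support.Nonempty := by
      rw [Finset.nonempty_iff_ne_empty, Ne, DFinsupp.support_eq_empty, hs]
      exact fun h => hne.2 ((DirectSum.decompose 𝒜).injective
        (h.trans (DirectSum.decompose_zero 𝒜).symm))
    obtain ⟨p, hp, q, hq, hu⟩ := UniqueSums.uniqueAdd_of_nonempty hr0 hs0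
    have h1 : ((r * s) (p + q) : E) = r p * s q := by
      rw [DirectSum.coe_mul_apply, Finset.sum_eq_single (p, q)]
      · intro x hx hxp
        rw [Finset.mem_filter, Finset.mem_product] at hx
        obtain ⟨h2, h3⟩ := hu hx.1.1 hx.1.2 hx.2
        exact absurd (Prod.ext h2 h3) hxp
      · intro h
        exact absurd (by simp only [Finset.mem_filter, Finset.mem_product]
                         exact ⟨⟨hp, hq⟩, trivial⟩) h
    rw [hrs] at h1
    rw [DFinsupp.mem_support_iff] at hp hq
    have hu1 : IsUnit (r p : E) := hE.isUnit _ _ (r p).2 (by simpa using hp)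
    have h4 : (s q : E) = 0 := (hu1.mul_right_eq_zero).mp (by rw [← h1]; simp)
    exact hq (by simpa using h4)
  exact NoZeroDivisors.to_isDomain E

/-! ### Homogeneous bases -/

/-- The ring `K` acts on `E` like a graded subring in which nonzero homogeneous elements are
invertible. -/
structure IsGradedScalars (K : Type*) [Ring K] [Module K E] : Prop where
  smul_one_injective : ∀ k : K, k • (1 : E) = 0 → k = 0
  proj : ∀ (k : K) (γ : Γ), ∃ k' : K, k' • (1 : E) = GradedRing.proj 𝒜 γ (k • (1 : E))
  inv : ∀ (k : K) (γ : Γ), k • (1 : E) ∈ 𝒜 γ → k ≠ 0 → ∃ k' : K, k' * k = 1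

omit hE in
theorem exists_proj_mul_eq_sum (a x : E) (γ : Γ) :
    ∃ s : Finset Γ, GradedRing.proj 𝒜 γ (a * x)
      = ∑ i ∈ s, GradedRing.proj 𝒜 i a * GradedRing.proj 𝒜 (γ - i) x := by
  classical
  refine ⟨(DirectSum.decompose 𝒜 a).support, ?_⟩
  conv_lhs => rw [← DirectSum.sum_support_decompose 𝒜 a, Finset.sum_mul, map_sum]
  exact Finset.sum_congr rfl fun i _ => proj_mul_left 𝒜 x (SetLike.coe_mem _)

omit hE in
/-- Graded vector spaces over graded division rings have homogeneous bases. -/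
theorem exists_homogeneous_basis {K : Type*} [Ring K] [Module K E] [IsScalarTower K E E]
    (hK : IsGradedScalars 𝒜 K) (V : Submodule K E)
    (hV : ∀ v ∈ V, ∀ γ, GradedRing.proj 𝒜 γ v ∈ V) :
    ∃ s : Set E, (∀ x ∈ s, ∃ γ, x ∈ 𝒜 γ) ∧ LinearIndepOn K id s ∧ Submodule.span K s = V := by
  obtain ⟨s, hs, hmax⟩ := exists_maximal_linearIndepOn K
    (fun v : {v : E // v ∈ V ∧ ∃ γ, v ∈ 𝒜 γ} => (v : E))
  have hsmul : ∀ (k : K) (x : E), k • x = (k • (1 : E)) * x := fun k x => by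
    rw [smul_mul_assoc, one_mul]
  set S := (fun v : {v : E // v ∈ V ∧ ∃ γ, v ∈ 𝒜 γ} => (v : E)) '' s with hS
  have hSh : ∀ x ∈ S, ∃ γ, x ∈ 𝒜 γ := by
    rintro _ ⟨v, _, rfl⟩
    exact v.2.2
  have hgr : ∀ x ∈ Submodule.span K S, ∀ γ, GradedRing.proj 𝒜 γ x ∈ Submodule.span K S := by
    intro x hx
    induction hx using Submodule.span_induction with
    | mem x hx =>
      intro γ
      obtain ⟨β, hβ⟩ := hSh x hx
      by_cases h : β = γ
      · subst h
        rw [proj_same 𝒜 hβ]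
        exact Submodule.subset_span hx
      · rw [proj_ne 𝒜 hβ h]
        exact zero_mem _
    | zero => simp
    | add x y _ _ hx hy =>
      intro γ
      rw [map_add]
      exact add_mem (hx γ) (hy γ)
    | smul k x _ hx =>
      intro γ
      obtain ⟨t, ht⟩ := exists_proj_mul_eq_sum 𝒜 (k • (1 : E)) x γ
      rw [hsmul, ht]
      refine Submodule.sum_mem _ fun i _ => ?_
      obtain ⟨k', hk'⟩ := hK.proj k i
      rw [← hk', ← hsmul]
      exact Submodule.smul_mem _ _ (hx _)
  refine ⟨S, hSh, ?_, le_antisymm ?_ ?_⟩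
  · exact hs.id_image
  · rw [Submodule.span_le]
    rintro _ ⟨v, _, rfl⟩
    exact v.2.1
  · intro v hv
    refine mem_of_proj_mem 𝒜 (V := (Submodule.span K S).toAddSubgroup) fun β => ?_
    change _ ∈ Submodule.span K S
    by_cases hin : (⟨_, hV v hv β, β, proj_mem 𝒜 β v⟩ : {v : E // v ∈ V ∧ ∃ γ, v ∈ 𝒜 γ}) ∈ s
    · exact Submodule.subset_span ⟨_, hin, rfl⟩
    obtain ⟨a, ha0, ha⟩ := hmax _ hin
    have ha1 : a • (1 : E) ≠ 0 := fun h => ha0 (hK.smul_one_injective a h)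
    obtain ⟨γ, hγ⟩ := exists_proj_ne_zero 𝒜 ha1
    obtain ⟨k, hk⟩ := hK.proj a γ
    have hk0 : k ≠ 0 := by
      rintro rfl
      exact hγ (by rw [← hk, zero_smul])
    obtain ⟨k', hk'⟩ := hK.inv k γ (by rw [hk]; exact proj_mem 𝒜 γ _) hk0
    have h := hgr _ ha (γ + β)
    rw [hsmul, proj_mul_right 𝒜 _ (proj_mem 𝒜 β v), add_sub_cancel_right, ← hk, ← hsmul] at h
    have h' := Submodule.smul_mem _ k' h
    rwa [smul_smul, hk', one_smul] at h'

theorem isGradedScalars_center : IsGradedScalars 𝒜 (Subring.center E) where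
  smul_one_injective k h := by
    rw [Subring.smul_def, smul_eq_mul, mul_one] at h
    exact Subtype.ext h
  proj k γ := by
    refine ⟨⟨_, proj_mem_center 𝒜 k.2 γ⟩, ?_⟩
    simp [Subring.smul_def]
  inv k γ hk h0 := by
    rw [Subring.smul_def, smul_eq_mul, mul_one] at hk
    obtain ⟨w, hw, -⟩ := isUnit_of_graded 𝒜 hk (fun h => h0 (Subtype.ext h))
    refine ⟨⟨_, center_inv_mem w (by rw [hw]; exact k.2)⟩, Subtype.ext ?_⟩
    simp [← hw]

/-! ### Bimodule relations -/

/-- If homogeneous `b i` are independent over the centralizer of a monoid `L` of homogeneous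
elements, then so are the maps `l ↦ l * b i` over `E`. A nontrivial relation of minimal length,
normalised to have a coefficient `1`, has all its coefficients in the centralizer. -/
theorem eq_zero_of_bimodule_relation (L : Submonoid E) (hL : ∀ l ∈ L, ∃ γ, l ∈ 𝒜 γ)
    {ι : Type*} [Fintype ι] (b : ι → E) (β : ι → Γ) (hb : ∀ i, b i ∈ 𝒜 (β i))
    (hind : ∀ c : ι → E, (∀ i, ∀ l ∈ L, c i * l = l * c i) → ∑ i, c i * b i = 0 → c = 0)
    (y : ι → E) (hy : ∀ l ∈ L, ∑ i, y i * l * b i = 0) : y = 0 := by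
  classical
  have := hE.nontrivial
  -- homogeneous relations, by induction on the number of nonzero coefficients
  have key : ∀ N : ℕ, ∀ (κ : Γ) (y : ι → E), (∀ i, y i ∈ 𝒜 (κ - β i)) →
      (∀ l ∈ L, ∑ i, y i * l * b i = 0) → (Finset.univ.filter fun i => y i ≠ 0).card = N →
      y = 0 := by
    intro N
    induction N using Nat.strong_induction_on with
    | _ N ih =>
    intro κ y hyh hy hN
    by_contra hne
    obtain ⟨i₀, hi₀⟩ : ∃ i, y i ≠ 0 := by
      by_contra! h
      exact hne (funext h)
    obtain ⟨w, hw, hwi⟩ := isUnit_of_graded 𝒜 (hyh i₀) hi₀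
    set y' : ι → E := fun i => ((w⁻¹ : Eˣ) : E) * y i with hy'
    have hy'0 : ∀ i, y' i = 0 ↔ y i = 0 := fun i => Units.mul_right_eq_zero _
    have hy'h : ∀ i, y' i ∈ 𝒜 (β i₀ - β i) := by
      intro i
      have := SetLike.GradedMul.mul_mem hwi (hyh i)
      rwa [show -(κ - β i₀) + (κ - β i) = β i₀ - β i by abel] at this
    have hy'rel : ∀ l ∈ L, ∑ i, y' i * l * b i = 0 := by
      intro l hl
      simp only [hy', mul_assoc]
      rw [← Finset.mul_sum]
      simp only [← mul_assoc]
      rw [hy l hl, mul_zero]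
    have hy'1 : y' i₀ = 1 := by simp [hy', ← hw]
    have hcomm : ∀ i, ∀ l ∈ L, y' i * l = l * y' i := by
      intro i l hl
      obtain ⟨lam, hlam⟩ := hL l hl
      let z : ι → E := fun i => y' i * l - l * y' i
      have hz : z = 0 := by
        refine ih _ ?_ (β i₀ + lam) z ?_ ?_ rfl
        · rw [← hN]
          refine Finset.card_lt_card (Finset.ssubset_iff_of_subset ?_ |>.mpr ⟨i₀, ?_, ?_⟩)
          · intro j hj
            simp only [Finset.mem_filter, Finset.mem_univ, true_and] at hj ⊢
            intro h
            apply hj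
            simp [z, (hy'0 j).mpr h]
          · simpa using hi₀
          · simp [z, hy'1]
        · intro j
          refine sub_mem ?_ ?_
          · have := SetLike.GradedMul.mul_mem (hy'h j) hlam
            rwa [show β i₀ - β j + lam = β i₀ + lam - β j by abel] at this
          · have := SetLike.GradedMul.mul_mem hlam (hy'h j)
            rwa [show lam + (β i₀ - β j) = β i₀ + lam - β j by abel] at this
        · intro l' hl'
          have h1 := hy'rel (l * l') (L.mul_mem hl hl')
          have h2 := hy'rel l' hl'
          calc ∑ i, z i * l' * b i
              = ∑ i, y' i * (l * l') * b i - l * ∑ i, y' i * l' * b i := by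
                rw [Finset.mul_sum, ← Finset.sum_sub_distrib]
                exact Finset.sum_congr rfl fun i _ => by simp only [z]; noncomm_ring
            _ = 0 := by rw [h1, h2, mul_zero, sub_zero]
      exact sub_eq_zero.mp (congrFun hz i)
    have h0 := hind y' hcomm (by simpa using hy'rel 1 L.one_mem)
    exact one_ne_zero (hy'1.symm.trans (congrFun h0 i₀))
  -- reduction to homogeneous relations
  funext i
  refine eq_of_proj_eq 𝒜 fun γ => ?_
  have h := key _ (γ + β i) (fun j => GradedRing.proj 𝒜 (γ + β i - β j) (y j))
    (fun j => proj_mem 𝒜 _ _) ?_ rfl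
  · have := congrFun h i
    simpa using this
  · intro l hl
    obtain ⟨lam, hlam⟩ := hL l hl
    have h := congrArg (GradedRing.proj 𝒜 (γ + β i + lam)) (hy l hl)
    rw [map_zero, map_sum] at h
    rw [← h]
    refine Finset.sum_congr rfl fun j _ => ?_
    rw [mul_assoc, mul_assoc, proj_mul_right 𝒜 _ (SetLike.GradedMul.mul_mem hlam (hb j))]
    congr 3
    abel

end GradedBasics

/-! ### Maximal graded subfields -/

section MaxComm

variable {Γ : Type v} {E : Type u} [Ring E]

/-- A maximal set of pairwise commuting homogeneous elements. In a graded division ring these are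
the homogeneous elements of a maximal graded subfield. -/
structure MaxCommHomog (𝒜 : Γ → AddSubgroup E) where
  carrier : Set E
  homog : ∀ x ∈ carrier, ∃ γ, x ∈ 𝒜 γ
  comm : ∀ x ∈ carrier, ∀ y ∈ carrier, x * y = y * x
  maximal : ∀ γ, ∀ x ∈ 𝒜 γ, (∀ y ∈ carrier, y * x = x * y) → x ∈ carrier

theorem exists_maxCommHomog (𝒜 : Γ → AddSubgroup E) (S : Set E) (hS : ∀ x ∈ S, ∃ γ, x ∈ 𝒜 γ)
    (hc : ∀ x ∈ S, ∀ y ∈ S, x * y = y * x) : ∃ H : MaxCommHomog 𝒜, S ⊆ H.carrier := by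
  obtain ⟨M, hSM, hM⟩ := zorn_subset_nonempty
    {X : Set E | (∀ x ∈ X, ∃ γ, x ∈ 𝒜 γ) ∧ ∀ x ∈ X, ∀ y ∈ X, x * y = y * x} (by
      intro c hcS hchain _
      refine ⟨⋃₀ c, ⟨?_, ?_⟩, fun s hs => Set.subset_sUnion_of_mem hs⟩
      · rintro x ⟨X, hX, hx⟩
        exact (hcS hX).1 x hx
      · rintro x ⟨X, hX, hx⟩ y ⟨Y, hY, hy⟩
        rcases hchain.total hX hY with h | h
        · exact (hcS hY).2 x (h hx) y hy
        · exact (hcS hX).2 x hx y (h hy)) S ⟨hS, hc⟩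
  refine ⟨⟨M, hM.prop.1, hM.prop.2, fun γ x hx h => ?_⟩, hSM⟩
  have hmem : insert x M ∈
      {X : Set E | (∀ x ∈ X, ∃ γ, x ∈ 𝒜 γ) ∧ ∀ x ∈ X, ∀ y ∈ X, x * y = y * x} := by
    refine ⟨?_, ?_⟩
    · rintro y (rfl | hy)
      · exact ⟨γ, hx⟩
      · exact hM.prop.1 y hy
    · rintro y (rfl | hy) z (rfl | hz)
      · rfl
      · exact (h z hz).symm
      · exact h y hy
      · exact hM.prop.2 y hy z hz
  exact hM.le_of_ge hmem (Set.subset_insert _ _) (Set.mem_insert _ _)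

namespace MaxCommHomog

variable {𝒜 : Γ → AddSubgroup E} (H : MaxCommHomog 𝒜)

/-- The maximal graded subfield with homogeneous elements `H`, as the centralizer of `H`. -/
def alg : Subalgebra (Subring.center E) E := Subalgebra.centralizer (Subring.center E) H.carrier

theorem mem_alg {x : E} : x ∈ H.alg ↔ ∀ h ∈ H.carrier, h * x = x * h :=
  Subalgebra.mem_centralizer_iff _

theorem mem_alg_of_mem {x : E} (hx : x ∈ H.carrier) : x ∈ H.alg :=
  H.mem_alg.mpr fun h hh => H.comm h hh x hx

theorem mem_carrier {γ : Γ} {x : E} (hx : x ∈ 𝒜 γ) (h : x ∈ H.alg) : x ∈ H.carrier :=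
  H.maximal γ x hx (H.mem_alg.mp h)

theorem center_le_alg {x : E} (hx : x ∈ Subring.center E) : x ∈ H.alg :=
  H.mem_alg.mpr fun h _ => Subring.mem_center_iff.mp hx h

theorem units_inv_mem_alg (w : Eˣ) (hw : (w : E) ∈ H.alg) : ((w⁻¹ : Eˣ) : E) ∈ H.alg := by
  rw [mem_alg] at hw ⊢
  intro h hh
  have h1 : Commute h (w : E) := hw h hh
  exact h1.units_inv_right

variable [AddCommGroup Γ] [DecidableEq Γ] [GradedRing 𝒜]

theorem proj_mem_alg {x : E} (hx : x ∈ H.alg) (γ : Γ) : GradedRing.proj 𝒜 γ x ∈ H.alg := by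
  rw [mem_alg] at hx ⊢
  intro h hh
  obtain ⟨β, hβ⟩ := H.homog h hh
  exact commute_proj 𝒜 hβ (hx h hh) γ

theorem alg_mul_comm {x y : E} (hx : x ∈ H.alg) (hy : y ∈ H.alg) : x * y = y * x := by
  have : ∀ γ, x * GradedRing.proj 𝒜 γ y = GradedRing.proj 𝒜 γ y * x := fun γ =>
    (H.mem_alg.mp hx _ (H.mem_carrier (proj_mem 𝒜 γ y) (H.proj_mem_alg hy γ))).symm
  classical
  rw [← DirectSum.sum_support_decompose 𝒜 y, Finset.mul_sum, Finset.sum_mul]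
  exact Finset.sum_congr rfl fun γ _ => this γ

instance : CommRing H.alg :=
  { (inferInstance : Ring H.alg) with
    mul_comm := fun x y => Subtype.ext (H.alg_mul_comm x.2 y.2) }

variable [hE : IsGradedDivisionRing 𝒜]

theorem isGradedScalars_alg : IsGradedScalars 𝒜 H.alg where
  smul_one_injective k h := by
    rw [Subalgebra.smul_def, smul_eq_mul, mul_one] at h
    exact Subtype.ext h
  proj k γ := by
    refine ⟨⟨_, H.proj_mem_alg k.2 γ⟩, ?_⟩
    simp [Subalgebra.smul_def]
  inv k γ hk h0 := by
    rw [Subalgebra.smul_def, smul_eq_mul, mul_one] at hk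
    obtain ⟨w, hw, -⟩ := isUnit_of_graded 𝒜 hk (fun h => h0 (Subtype.ext h))
    refine ⟨⟨_, H.units_inv_mem_alg w (by rw [hw]; exact k.2)⟩, Subtype.ext ?_⟩
    simp [← hw]

/-- The monoid of homogeneous elements of the subfield. -/
def submonoid : Submonoid E where
  carrier := H.carrier
  one_mem' := H.mem_carrier SetLike.GradedOne.one_mem H.alg.one_mem
  mul_mem' := by
    intro a b ha hb
    obtain ⟨α, hα⟩ := H.homog a ha
    obtain ⟨β, hβ⟩ := H.homog b hb
    exact H.mem_carrier (SetLike.GradedMul.mul_mem hα hβ)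
      (H.alg.mul_mem (H.mem_alg_of_mem ha) (H.mem_alg_of_mem hb))

end MaxCommHomog

end MaxComm

/-! ### Splitting by a maximal graded subfield -/

section HomogeneousBases

variable {Γ : Type v} [AddCommGroup Γ] [DecidableEq Γ] {E : Type u} [Ring E]
variable {𝒜 : Γ → AddSubgroup E} [GradedRing 𝒜] [hE : IsGradedDivisionRing 𝒜]

include hE in
theorem exists_homogeneous_basis_center [Module.Finite (Subring.center E) E] :
    ∃ (ε : Type u) (_ : Fintype ε) (e : Module.Basis ε (Subring.center E) E) (d : ε → Γ),
      ∀ k, e k ∈ 𝒜 (d k) := by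
  have := hE.nontrivial
  obtain ⟨s, hs, hli, hspan⟩ := exists_homogeneous_basis 𝒜 (isGradedScalars_center 𝒜) ⊤ (by simp)
  let e : Module.Basis s (Subring.center E) E := Module.Basis.mk (v := fun x : s => (x : E)) hli
    (by simpa using hspan.ge)
  have := Module.Finite.finite_basis e
  choose d hd using fun k : s => hs k k.2
  exact ⟨s, Fintype.ofFinite s, e, d, fun k => by
    rw [show e k = k from Module.Basis.mk_apply _ _ _]
    exact hd k⟩

variable (𝒜) in
include hE in
theorem free_center [Module.Finite (Subring.center E) E] : Module.Free (Subring.center E) E := by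
  obtain ⟨ι, _, b, -⟩ := exists_homogeneous_basis_center (𝒜 := 𝒜)
  exact Module.Free.of_basis b

variable (H : MaxCommHomog 𝒜)

include hE

theorem MaxCommHomog.isDomain_alg [IsAddTorsionFree Γ] : IsDomain H.alg := by
  have := isDomain_of_isGradedDivisionRing 𝒜
  have := hE.nontrivial
  have : NoZeroDivisors H.alg := inferInstance
  have : Nontrivial H.alg := inferInstance
  exact NoZeroDivisors.to_isDomain _

variable [Module.Finite (Subring.center E) E]

instance MaxCommHomog.finite_right : Module.Finite H.alg E :=
  Module.Finite.of_restrictScalars_finite (Subring.center E) H.alg E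

theorem MaxCommHomog.exists_homogeneous_basis_alg :
    ∃ (β : Type u) (_ : Fintype β) (b : Module.Basis β H.alg E) (d : β → Γ),
      ∀ k, b k ∈ 𝒜 (d k) := by
  have := hE.nontrivial
  obtain ⟨s, hs, hli, hspan⟩ := exists_homogeneous_basis 𝒜 H.isGradedScalars_alg ⊤ (by simp)
  let e : Module.Basis s H.alg E := Module.Basis.mk (v := fun x : s => (x : E)) hli
    (by simpa using hspan.ge)
  have := Module.Finite.finite_basis e
  choose d hd using fun k : s => hs k k.2
  exact ⟨s, Fintype.ofFinite s, e, d, fun k => by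
    rw [show e k = k from Module.Basis.mk_apply _ _ _]
    exact hd k⟩

theorem MaxCommHomog.exists_basis_center_alg :
    ∃ (ι : Type u) (_ : Fintype ι), Nonempty (Module.Basis ι (Subring.center E) H.alg) := by
  have := hE.nontrivial
  obtain ⟨s, hs, hli, hspan⟩ := exists_homogeneous_basis 𝒜 (isGradedScalars_center 𝒜)
    (Subalgebra.toSubmodule H.alg) (fun v hv γ => H.proj_mem_alg hv γ)
  have hfin : Finite s := hli.finite
  have hli' : LinearIndependent (Subring.center E) (fun x : s => (x : E)) := hli
  let b := (Module.Basis.span hli').map (LinearEquiv.ofEq _ (Subalgebra.toSubmodule H.alg)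
    (by simpa using hspan))
  exact ⟨s, Fintype.ofFinite s, ⟨b⟩⟩

instance MaxCommHomog.free_alg : Module.Free (Subring.center E) H.alg := by
  obtain ⟨ι, _, ⟨b⟩⟩ := H.exists_basis_center_alg
  exact Module.Free.of_basis b

instance MaxCommHomog.finite_alg : Module.Finite (Subring.center E) H.alg := by
  obtain ⟨ι, _, ⟨b⟩⟩ := H.exists_basis_center_alg
  exact Module.Finite.of_basis b

instance MaxCommHomog.free_right : Module.Free H.alg E := by
  obtain ⟨ι, _, b, -⟩ := H.exists_homogeneous_basis_alg
  exact Module.Free.of_basis b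

end HomogeneousBases

section Splitting

variable {Γ : Type v} [AddCommGroup Γ] [DecidableEq Γ] {E : Type u} [Ring E]
variable {𝒜 : Γ → AddSubgroup E} [GradedRing 𝒜] [hE : IsGradedDivisionRing 𝒜]

/-- The matrices of the right multiplications in a basis of `E` as a left module over a maximal
graded subfield. -/
def MaxCommHomog.rightMulMatrix (H : MaxCommHomog 𝒜) {β : Type*} [Fintype β] [DecidableEq β]
    (b : Module.Basis β H.alg E) : E →ₐ[Subring.center E] Matrix β β H.alg :=
  AlgHom.ofLinearMap
    { toFun := fun a => (LinearMap.toMatrix b b (LinearMap.mulRight H.alg a)).transpose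
      map_add' := fun x y => by
        rw [← Matrix.transpose_add, ← map_add]
        congr 2
        ext z
        simp [mul_add]
      map_smul' := fun c x => by
        ext i j
        simp only [LinearMap.toMatrix_apply, Matrix.transpose_apply, LinearMap.mulRight_apply,
          RingHom.id_apply, Matrix.smul_apply]
        rw [mul_smul_comm, ← Finsupp.smul_apply, ← algebraMap_smul H.alg c (b i * x),
          map_smul, algebraMap_smul] }
    (by
      change (LinearMap.toMatrix b b (LinearMap.mulRight H.alg 1)).transpose = 1
      rw [LinearMap.mulRight_one, LinearMap.toMatrix_id, Matrix.transpose_one])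
    (fun x y => by
      change (LinearMap.toMatrix b b (LinearMap.mulRight H.alg (x * y))).transpose
        = (LinearMap.toMatrix b b (LinearMap.mulRight H.alg x)).transpose
          * (LinearMap.toMatrix b b (LinearMap.mulRight H.alg y)).transpose
      rw [LinearMap.mulRight_mul, LinearMap.toMatrix_comp b b b, Matrix.transpose_mul])

omit hE in
theorem MaxCommHomog.rightMulMatrix_apply (H : MaxCommHomog 𝒜) {β : Type*} [Fintype β]
    [DecidableEq β] (b : Module.Basis β H.alg E) (a : E) (i j : β) :
    H.rightMulMatrix b a i j = b.repr (b i * a) j := by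
  change (LinearMap.toMatrix b b (LinearMap.mulRight H.alg a)).transpose i j = _
  simp [LinearMap.toMatrix_apply]

omit hE in
/-- The determinant of a matrix over a graded subfield is homogeneous, if the entry `(i, j)` has
degree `r i + c j`. -/
theorem MaxCommHomog.det_mem (H : MaxCommHomog 𝒜) {n : Type*} [Fintype n] [DecidableEq n]
    (D : Matrix n n H.alg) (r c : n → Γ) (hD : ∀ i j, (D i j : E) ∈ 𝒜 (r i + c j)) :
    (D.det : E) ∈ 𝒜 (∑ i, r i + ∑ i, c i) := by
  have hprod : ∀ (s : Finset n) (f : n → H.alg) (g : n → Γ), (∀ i, (f i : E) ∈ 𝒜 (g i)) →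
      ((∏ i ∈ s, f i : H.alg) : E) ∈ 𝒜 (∑ i ∈ s, g i) := by
    intro s f g h
    induction s using Finset.induction_on with
    | empty => simpa using SetLike.GradedOne.one_mem
    | insert a s ha ih =>
      rw [Finset.prod_insert ha, Finset.sum_insert ha]
      exact SetLike.GradedMul.mul_mem (h a) ih
  rw [Matrix.det_apply, AddSubmonoidClass.coe_finsetSum]
  refine sum_mem fun σ _ => ?_
  have h := hprod Finset.univ (fun i => D (σ i) i) (fun i => r (σ i) + c i) fun i => hD _ _
  rw [Finset.sum_add_distrib, Equiv.sum_comp σ r] at h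
  rcases Int.units_eq_one_or (Equiv.Perm.sign σ) with hs | hs
  · rw [hs, one_smul]
    exact h
  · rw [hs, Units.neg_smul, one_smul]
    exact neg_mem h

variable (H : MaxCommHomog 𝒜)

/-- Right multiplications are linearly independent over the maximal graded subfield. -/
theorem MaxCommHomog.eq_zero_of_sum_smul_rightMulMatrix {β : Type*} [Fintype β] [DecidableEq β]
    (b : Module.Basis β H.alg E) {ε : Type*} [Fintype ε]
    (e : Module.Basis ε (Subring.center E) E) (d : ε → Γ) (he : ∀ k, e k ∈ 𝒜 (d k))
    (l : ε → H.alg) (h : ∑ k, l k • H.rightMulMatrix b (e k) = 0) : l = 0 := by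
  have h1 : ∀ i, ∑ k, (l k : E) * b i * e k = 0 := by
    intro i
    apply b.repr.injective
    ext1 j
    have := congrFun (congrFun h i) j
    simp only [Matrix.sum_apply, Matrix.smul_apply, rightMulMatrix_apply, Matrix.zero_apply] at this
    rw [map_sum, Finsupp.finsetSum_apply, map_zero, Finsupp.zero_apply, ← this]
    refine Finset.sum_congr rfl fun k _ => ?_
    rw [← Finsupp.smul_apply, ← map_smul, mul_assoc, Subalgebra.smul_def, smul_eq_mul]
  have h2 : ∀ x : E, ∑ k, (l k : E) * x * e k = 0 := by
    intro x
    have hx := b.sum_repr x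
    calc ∑ k, (l k : E) * x * e k
        = ∑ i, (b.repr x i : E) * ∑ k, (l k : E) * b i * e k := by
          conv_lhs => rw [← hx]
          simp only [Finset.mul_sum, Finset.sum_mul]
          rw [Finset.sum_comm]
          refine Finset.sum_congr rfl fun i _ => Finset.sum_congr rfl fun k _ => ?_
          rw [Subalgebra.smul_def, smul_eq_mul]
          simp only [← mul_assoc]
          rw [H.alg_mul_comm (l k).2 (b.repr x i).2]
      _ = 0 := by simp [h1]
  have h3 := eq_zero_of_bimodule_relation 𝒜 (SetLike.homogeneousSubmonoid 𝒜) (fun l hl => hl)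
    (fun k => e k) d he ?_ (fun k => (l k : E)) (fun x _ => h2 x)
  · funext k
    exact Subtype.ext (congrFun h3 k)
  · intro c hc h0
    have hcen : ∀ k, c k ∈ Subring.center E := by
      intro k
      rw [Subring.mem_center_iff]
      exact commute_of_commute_homogeneous 𝒜 fun γ x hx => (hc k x ⟨γ, hx⟩).symm
    have := Fintype.linearIndependent_iff.mp e.linearIndependent (fun k => ⟨c k, hcen k⟩) h0
    funext k
    exact congrArg Subtype.val (this k)

variable [Module.Finite (Subring.center E) E]

/-- The dimension of `E` over a maximal graded subfield is at most the dimension of the subfield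
over the center. -/
theorem MaxCommHomog.card_le_card {β : Type*} [Fintype β]
    (b : Module.Basis β H.alg E) (d : β → Γ) (hb : ∀ k, b k ∈ 𝒜 (d k))
    {ι : Type*} [Fintype ι] (c : Module.Basis ι (Subring.center E) H.alg) :
    Fintype.card β ≤ Fintype.card ι := by
  have := hE.nontrivial
  have := free_center 𝒜
  have : Nontrivial (Subring.center E) := inferInstance
  let Θ : (β → E) →ₗ[Subring.center E] (ι → E) :=
    LinearMap.pi fun k => ∑ j, LinearMap.mulRight (Subring.center E) ((c k : E) * b j) ∘ₗ
      LinearMap.proj j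
  have hΘ : Function.Injective Θ := by
    rw [← LinearMap.ker_eq_bot, LinearMap.ker_eq_bot']
    intro y hy
    have h1 : ∀ k, ∑ j, y j * (c k : E) * b j = 0 := by
      intro k
      have := congrFun hy k
      simpa [Θ, mul_assoc] using this
    refine eq_zero_of_bimodule_relation 𝒜 H.submonoid H.homog (fun j => b j) d hb ?_ y ?_
    · intro z hz h0
      have hzm : ∀ j, z j ∈ H.alg := fun j => H.mem_alg.mpr fun h hh => (hz j h hh).symm
      have := Fintype.linearIndependent_iff.mp b.linearIndependent (fun j => ⟨z j, hzm j⟩) h0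
      funext k
      exact congrArg Subtype.val (this k)
    · intro l hl
      have hl' := c.sum_repr ⟨l, H.mem_alg_of_mem hl⟩
      have hl2 : l = ∑ k, ((c.repr ⟨l, H.mem_alg_of_mem hl⟩ k : Subring.center E) : E) * c k := by
        conv_lhs => rw [show l = ((⟨l, H.mem_alg_of_mem hl⟩ : H.alg) : E) from rfl, ← hl']
        rw [AddSubmonoidClass.coe_finsetSum]
        exact Finset.sum_congr rfl fun k _ => rfl
      generalize (c.repr ⟨l, H.mem_alg_of_mem hl⟩) = t at hl2
      calc ∑ j, y j * l * b j = ∑ k, ((t k : Subring.center E) : E) * ∑ j, y j * c k * b j := by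
            conv_lhs => rw [hl2]
            simp only [Finset.mul_sum, Finset.sum_mul]
            rw [Finset.sum_comm]
            refine Finset.sum_congr rfl fun k _ => Finset.sum_congr rfl fun j _ => ?_
            simp only [← mul_assoc]
            rw [Subring.mem_center_iff.mp (t k).2 (y j)]
        _ = 0 := by simp [h1]
  have h := LinearMap.finrank_le_finrank_of_injective hΘ
  rw [Module.finrank_pi_fintype, Module.finrank_pi_fintype] at h
  simp only [Finset.sum_const, Finset.card_univ, smul_eq_mul] at h
  obtain ⟨ε, _, e, -⟩ := exists_homogeneous_basis_center (𝒜 := 𝒜)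
  have := e.index_nonempty
  rw [Module.finrank_eq_card_basis e] at h
  exact Nat.le_of_mul_le_mul_right h Fintype.card_pos

theorem MaxCommHomog.finrank_eq : Module.finrank H.alg E = Module.finrank (Subring.center E) H.alg ∧
    Module.finrank (Subring.center E) E = Module.finrank (Subring.center E) H.alg ^ 2 := by
  classical
  have := hE.nontrivial
  obtain ⟨β, _, b, d, hb⟩ := H.exists_homogeneous_basis_alg
  obtain ⟨ε, _, e, d', he⟩ := exists_homogeneous_basis_center (𝒜 := 𝒜)
  obtain ⟨ι, _, ⟨c⟩⟩ := H.exists_basis_center_alg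
  have : Nontrivial (Subring.center E) := inferInstance
  have : Nontrivial H.alg := inferInstance
  have hmul := Module.finrank_mul_finrank (Subring.center E) H.alg E
  have h1 := H.card_le_card b d hb c
  have h2 : Fintype.card ε ≤ Fintype.card β * Fintype.card β := by
    have hli : LinearIndependent H.alg fun k => H.rightMulMatrix b (e k) :=
      Fintype.linearIndependent_iff.mpr fun l hl =>
        congrFun (H.eq_zero_of_sum_smul_rightMulMatrix b e d' he l hl)
    simpa [Module.finrank_matrix] using hli.fintype_card_le_finrank
  rw [Module.finrank_eq_card_basis b, Module.finrank_eq_card_basis e,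
    Module.finrank_eq_card_basis c] at *
  rw [← hmul] at h2
  have h3 : Fintype.card ι ≤ Fintype.card β := by
    by_contra hlt
    push Not at hlt
    have := b.index_nonempty
    have hβ : 0 < Fintype.card β := Fintype.card_pos
    nlinarith
  have h4 : Fintype.card β = Fintype.card ι := le_antisymm h1 h3
  refine ⟨h4, ?_⟩
  rw [← hmul, h4, sq]

/-- A maximal graded subfield splits `E`: right multiplications give an isomorphism onto the full
matrix ring, because the determinant of the structure map in homogeneous bases is a nonzero
homogeneous element. -/
theorem MaxCommHomog.exists_splitting [IsAddTorsionFree Γ] :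
    Nonempty (H.alg ⊗[Subring.center E] E ≃ₐ[H.alg]
      Matrix (Fin (Module.finrank (Subring.center E) H.alg))
        (Fin (Module.finrank (Subring.center E) H.alg)) H.alg) := by
  classical
  have := hE.nontrivial
  have := H.isDomain_alg
  obtain ⟨hr1, hr2⟩ := H.finrank_eq
  set n := Module.finrank (Subring.center E) H.alg with hn
  obtain ⟨β, _, b', d', hb'⟩ := H.exists_homogeneous_basis_alg
  obtain ⟨ε, _, e', f', he'⟩ := exists_homogeneous_basis_center (𝒜 := 𝒜)
  have hβ : Fintype.card β = n := by rw [← hr1, Module.finrank_eq_card_basis b']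
  have hε : Fintype.card ε = Fintype.card (Fin n × Fin n) := by
    rw [← Module.finrank_eq_card_basis e', hr2]
    simp [sq]
  let σ : β ≃ Fin n := Fintype.equivFinOfCardEq hβ
  let τ : ε ≃ Fin n × Fin n := Fintype.equivOfCardEq hε
  let b := b'.reindex σ
  let e := e'.reindex τ
  let d := d' ∘ σ.symm
  let f := f' ∘ τ.symm
  have hb : ∀ i, b i ∈ 𝒜 (d i) := fun i => by
    simpa [b, d] using hb' (σ.symm i)
  have he : ∀ k, e k ∈ 𝒜 (f k) := fun i => by
    rw [Module.Basis.reindex_apply]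
    exact he' (τ.symm i)
  let Ψ : H.alg ⊗[Subring.center E] E →ₐ[H.alg] Matrix (Fin n) (Fin n) H.alg :=
    Algebra.TensorProduct.lift (Algebra.ofId _ _) (H.rightMulMatrix b)
      (fun x y => Algebra.commutes x _)
  have hΨ : ∀ a, Ψ (1 ⊗ₜ a) = H.rightMulMatrix b a := fun a =>
    (Algebra.TensorProduct.lift_tmul _ _ _ _ _).trans (by rw [map_one, one_mul])
  let v := e.baseChange H.alg
  let w := Matrix.stdBasis H.alg (Fin n) (Fin n)
  let D := LinearMap.toMatrix v w Ψ.toLinearMap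
  have hD : ∀ p k, D p k = H.rightMulMatrix b (e k) p.1 p.2 := by
    intro p k
    simp only [D, LinearMap.toMatrix_apply, v, Module.Basis.baseChange_apply,
      AlgHom.toLinearMap_apply, hΨ]
    rfl
  have hDh : ∀ p k, (D p k : E) ∈ 𝒜 ((d p.1 - d p.2) + f k) := by
    intro p k
    rw [hD, H.rightMulMatrix_apply]
    have hx := SetLike.GradedMul.mul_mem (hb p.1) (he k)
    -- the coordinates of a homogeneous element in a homogeneous basis are homogeneous
    have hrep : b.repr (b p.1 * e k) = b.repr (∑ j, (⟨GradedRing.proj 𝒜 (d p.1 + f k - d j)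
        (b.repr (b p.1 * e k) j), H.proj_mem_alg (b.repr (b p.1 * e k) j).2 _⟩ : H.alg) • b j) := by
      congr 1
      have h := congrArg (GradedRing.proj 𝒜 (d p.1 + f k)) (b.sum_repr (b p.1 * e k))
      rw [proj_same 𝒜 hx, map_sum] at h
      conv_lhs => rw [← h]
      refine Finset.sum_congr rfl fun j _ => ?_
      rw [Subalgebra.smul_def, smul_eq_mul, proj_mul_right 𝒜 _ (hb j), Subalgebra.smul_def,
        smul_eq_mul]
    rw [DFunLike.congr_fun hrep p.2, congrFun (b.repr_sum_self _) p.2,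
      show d p.1 - d p.2 + f k = d p.1 + f k - d p.2 by abel]
    exact proj_mem 𝒜 _ _
  have hdeth : (D.det : E) ∈ 𝒜 _ := H.det_mem D _ f hDh
  have hdet0 : D.det ≠ 0 := by
    intro h0
    obtain ⟨l, hl0, hl⟩ := Matrix.exists_mulVec_eq_zero_iff.mpr h0
    apply hl0
    refine H.eq_zero_of_sum_smul_rightMulMatrix b e f he l ?_
    ext1 i j
    have := congrFun hl (i, j)
    simp only [Matrix.mulVec, dotProduct, hD, Pi.zero_apply] at this
    rw [Matrix.sum_apply, Matrix.zero_apply, ← this]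
    exact Finset.sum_congr rfl fun k _ => mul_comm _ _
  have hunit : IsUnit D.det := by
    obtain ⟨u, hu, -⟩ := isUnit_of_graded 𝒜 hdeth (fun h => hdet0 (Subtype.ext h))
    refine IsUnit.of_mul_eq_one (⟨_, H.units_inv_mem_alg u (by rw [hu]; exact D.det.2)⟩ : H.alg)
      (Subtype.ext ?_)
    simp [← hu]
  let Φ := LinearEquiv.ofIsUnitDet (f := Ψ.toLinearMap) (v := v) (v' := w) hunit
  exact ⟨AlgEquiv.ofBijective Ψ Φ.bijective⟩

theorem MaxCommHomog.faithfullyFlat : Module.FaithfullyFlat (Subring.center E) H.alg := by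
  have := hE.nontrivial
  infer_instance

end Splitting

/-! ### The reduced norm of a graded division ring -/

section NormOfGraded

variable {Γ : Type v} [AddCommGroup Γ] [IsAddTorsionFree Γ] [DecidableEq Γ] {E : Type u} [Ring E]
variable {𝒜 : Γ → AddSubgroup E} [GradedRing 𝒜] [hE : IsGradedDivisionRing 𝒜]
variable [Module.Finite (Subring.center E) E]

variable (𝒜) in
include hE in
theorem existsUnique_isReducedNorm_of_graded :
    ∃! f : E →* Subring.center E, IsReducedNorm E f := by
  obtain ⟨H, -⟩ := exists_maxCommHomog 𝒜 ∅ (by simp) (by simp)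
  obtain ⟨φ⟩ := H.exists_splitting
  have := H.faithfullyFlat
  exact existsUnique_isReducedNorm E φ

omit [IsAddTorsionFree Γ] in
theorem MaxCommHomog.algIndex_eq (H : MaxCommHomog 𝒜) :
    algIndex E = Module.finrank (Subring.center E) H.alg := by
  rw [algIndex, H.finrank_eq.2, sq, Nat.sqrt_eq]

omit [IsAddTorsionFree Γ] in
variable (𝒜) in
include hE in
theorem algIndex_sq_of_graded : algIndex E ^ 2 = Module.finrank (Subring.center E) E := by
  obtain ⟨H, -⟩ := exists_maxCommHomog 𝒜 ∅ (by simp) (by simp)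
  rw [H.algIndex_eq, H.finrank_eq.2]

omit [IsAddTorsionFree Γ] in
variable (𝒜) in
include hE in
theorem algIndex_pos_of_graded : 0 < algIndex E := by
  have := hE.nontrivial
  obtain ⟨H, -⟩ := exists_maxCommHomog 𝒜 ∅ (by simp) (by simp)
  obtain ⟨ι, _, ⟨c⟩⟩ := H.exists_basis_center_alg
  have := c.index_nonempty
  rw [H.algIndex_eq, Module.finrank_eq_card_basis c]
  exact Fintype.card_pos

/-- The reduced norm restricts to the norm on maximal graded subfields. Both characteristic
polynomials have the same `n`-th power, the characteristic polynomial of left multiplication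
on `E`. -/
theorem MaxCommHomog.reducedNorm_eq_norm (H : MaxCommHomog 𝒜) (a : H.alg) :
    reducedNorm E a = Algebra.norm (Subring.center E) a := by
  have := hE.nontrivial
  have := H.isDomain_alg
  have := free_center 𝒜
  have := H.faithfullyFlat
  obtain ⟨φ⟩ := H.exists_splitting
  set n := Module.finrank (Subring.center E) H.alg with hn
  have hn0 : n ≠ 0 := by
    rw [hn, ← H.algIndex_eq]
    exact (algIndex_pos_of_graded 𝒜).ne'
  have hinj : Function.Injective (algebraMap (Subring.center E) H.alg) :=
    FaithfulSMul.algebraMap_injective _ _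
  apply hinj
  rw [algebraMap_reducedNorm E φ]
  obtain ⟨β, _, b, -⟩ := H.exists_homogeneous_basis_alg
  have hβ : Fintype.card β = n := by rw [← Module.finrank_eq_card_basis b, H.finrank_eq.1]
  have h1 : (Algebra.lmul (Subring.center E) E (a : E)).charpoly
      = (Algebra.lmul (Subring.center E) H.alg a).charpoly ^ n := by
    have := charpoly_lmul_of_tower (R := Subring.center E) b a
    rwa [hβ, Subalgebra.smul_def, smul_eq_mul, mul_one] at this
  have h2 : (φ (1 ⊗ₜ (a : E))).charpoly ^ n
      = ((Algebra.lmul (Subring.center E) E (a : E)).charpoly).map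
        (algebraMap (Subring.center E) H.alg) := by
    have h := Matrix.charpoly_lmul (φ (1 ⊗ₜ (a : E)))
    rw [Fintype.card_fin] at h
    rw [← h, ← LinearMap.charpoly_baseChange, Algebra.baseChange_lmul]
    rw [← LinearEquiv.charpoly_conj φ.toLinearEquiv]
    congr 1
    refine LinearMap.ext fun x => ?_
    simp [LinearEquiv.conj_apply]
  have h3 : (φ (1 ⊗ₜ (a : E))).charpoly
      = ((Algebra.lmul (Subring.center E) H.alg a).charpoly).map
        (algebraMap (Subring.center E) H.alg) := by
    refine Polynomial.Monic.eq_of_pow_eq_pow (Matrix.charpoly_monic _)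
      ((LinearMap.charpoly_monic _).map _) hn0 ?_
    rw [h2, h1, Polynomial.map_pow]
  rw [Matrix.det_eq_sign_charpoly_coeff, h3, Algebra.norm_apply,
    LinearMap.det_eq_sign_charpoly_coeff, Polynomial.coeff_map, Fintype.card_fin]
  simp [hn, Algebra.coe_lmul_eq_mul]

variable (𝒜) in
include hE in
/-- On the center the reduced norm is the `ind(E)`-th power. -/
theorem reducedNorm_center_of_graded (t : Subring.center E) :
    reducedNorm E (t : E) = t ^ algIndex E := by
  obtain ⟨H, -⟩ := exists_maxCommHomog 𝒜 ∅ (by simp) (by simp)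
  have h := H.reducedNorm_eq_norm (algebraMap _ _ t)
  rwa [Algebra.norm_algebraMap, ← H.algIndex_eq] at h

end NormOfGraded

/-! ### Division rings with the trivial grading -/

section Trivial

/-- The grading of a ring by the trivial group. -/
def trivialGrading (A : Type u) [Ring A] : Unit → AddSubgroup A := fun _ => ⊤

/-- The decomposition of the trivial grading. -/
def trivialDecompose (A : Type u) [Ring A] : A →+ DirectSum Unit fun i => trivialGrading A i :=
  (DirectSum.of (fun i => trivialGrading A i) ()).comp
    ((AddMonoidHom.id A).codRestrict (⊤ : AddSubgroup A) fun _ => AddSubgroup.mem_top _)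

instance (A : Type u) [Ring A] : GradedRing (trivialGrading A) where
  one_mem := AddSubgroup.mem_top _
  mul_mem _ _ _ _ _ _ := AddSubgroup.mem_top _
  toDecomposition := DirectSum.Decomposition.ofAddHom (trivialGrading A) (trivialDecompose A)
    (by
      ext a
      exact DirectSum.coeAddMonoidHom_of (trivialGrading A) () ⟨a, AddSubgroup.mem_top _⟩)
    (by
      ext i x
      simp [trivialDecompose]
      rfl)

end Trivial

/-! ### The degree zero part -/

theorem Module.Free.of_isField {K M : Type*} [CommRing K] (h : IsField K) [AddCommGroup M]
    [Module K M] : Module.Free K M := by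
  let := h.toField
  exact Module.Free.of_divisionRing K M

section DegZero

variable {Γ : Type v} [AddCommGroup Γ] [DecidableEq Γ] {E : Type u} [Ring E]
variable (𝒜 : Γ → AddSubgroup E) [GradedRing 𝒜] [hE : IsGradedDivisionRing 𝒜]

instance isGradedDivisionRing_degZero : IsGradedDivisionRing (trivialGrading (degZero 𝒜)) where
  nontrivial := by
    have := hE.nontrivial
    infer_instance
  isUnit _ a _ ha := by
    obtain ⟨w, hw, hw'⟩ := isUnit_of_graded 𝒜 a.2 (fun h => ha (Subtype.ext h))
    rw [neg_zero] at hw'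
    exact ⟨⟨a, ⟨_, hw'⟩, Subtype.ext (by simp [← hw]), Subtype.ext (by simp [← hw])⟩, rfl⟩

theorem isField_of_inv_mem {K : Type*} [CommRing K] [Nontrivial K]
    (h : ∀ x : K, x ≠ 0 → ∃ y, x * y = 1) : IsField K where
  exists_pair_ne := exists_pair_ne K
  mul_comm := mul_comm
  mul_inv_cancel := fun {a} ha => h a ha

theorem isField_centerZero : IsField (centerZero 𝒜) := by
  have := hE.nontrivial
  refine isField_of_inv_mem fun x hx => ?_
  obtain ⟨w, hw⟩ := (isGradedDivisionRing_degZero 𝒜).isUnit () (x : degZero 𝒜)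
    (AddSubgroup.mem_top _) (fun h => hx (Subtype.ext h))
  refine ⟨⟨_, center_inv_mem w (by rw [hw]; exact x.2)⟩, Subtype.ext ?_⟩
  simp [← hw]

omit hE in
theorem mem_center_degZero {x : degZero 𝒜} (hx : (x : E) ∈ Subring.center E) :
    x ∈ centerZero 𝒜 := by
  rw [Subring.mem_center_iff] at hx ⊢
  exact fun g => Subtype.ext (hx g)

/-- An element of `T ∩ E₀` as an element of `T₀`. -/
def toBaseZero (x : E) (h0 : x ∈ 𝒜 0) (hx : x ∈ Subring.center E) : baseZero 𝒜 :=
  ⟨⟨⟨x, h0⟩, mem_center_degZero 𝒜 (x := ⟨x, h0⟩) hx⟩, hx⟩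

/-- The inclusion `T₀ → T`. -/
def baseToCenter : baseZero 𝒜 →+* Subring.center E where
  toFun x := ⟨(((x : centerZero 𝒜) : degZero 𝒜) : E), x.2⟩
  map_one' := rfl
  map_mul' _ _ := rfl
  map_zero' := rfl
  map_add' _ _ := rfl

omit hE in
theorem baseToCenter_injective : Function.Injective (baseToCenter 𝒜) := fun _ _ h =>
  Subtype.ext (Subtype.ext (Subtype.ext (congrArg (fun z : Subring.center E => (z : E)) h)))

omit hE in
@[simp]
theorem coe_baseToCenter (x : baseZero 𝒜) :
    ((baseToCenter 𝒜 x : Subring.center E) : E) = (((x : centerZero 𝒜) : degZero 𝒜) : E) := rfl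

theorem isField_baseZero : IsField (baseZero 𝒜) := by
  have := hE.nontrivial
  refine isField_of_inv_mem fun x hx => ?_
  obtain ⟨w, hw, hw'⟩ := isUnit_of_graded 𝒜 ((x : centerZero 𝒜) : degZero 𝒜).2
    (fun h => hx (Subtype.ext (Subtype.ext (Subtype.ext h))))
  rw [neg_zero] at hw'
  refine ⟨toBaseZero 𝒜 _ hw' (center_inv_mem w (by rw [hw]; exact x.2)), ?_⟩
  apply baseToCenter_injective
  apply Subtype.ext
  rw [map_mul, Subring.coe_mul]
  simp [← hw, toBaseZero]

instance free_base {M : Type*} [AddCommGroup M] [Module (baseZero 𝒜) M] :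
    Module.Free (baseZero 𝒜) M := Module.Free.of_isField (isField_baseZero 𝒜)

instance free_centerZero {M : Type*} [AddCommGroup M] [Module (centerZero 𝒜) M] :
    Module.Free (centerZero 𝒜) M := Module.Free.of_isField (isField_centerZero 𝒜)

variable {𝒜} in
/-- Products of elements of `E₀` that are independent over `T₀` with homogeneous units in distinct
classes modulo `Γ_T` are independent over `T`. -/
theorem linearIndependent_mul_units {ι κ : Type*} {m : ι → degZero 𝒜}
    (hm : LinearIndependent (baseZero 𝒜) m) (c : κ → Eˣ) (g : κ → Γ)
    (hc : ∀ j, (c j : E) ∈ 𝒜 (g j))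
    (hg : ∀ j j', g j - g j' ∈ gradeGroupCenter 𝒜 → j = j') :
    LinearIndependent (Subring.center E) fun p : ι × κ => (m p.1 : E) * c p.2 := by
  classical
  rw [linearIndependent_iff'']
  intro s t hts hsum p
  by_contra hp
  obtain ⟨i₀, j₀⟩ := p
  obtain ⟨δ, hδ⟩ := exists_proj_ne_zero 𝒜 (x := (t (i₀, j₀) : E)) (fun h => hp (Subtype.ext h))
  obtain ⟨u, hu, hui⟩ := isUnit_of_graded 𝒜 (proj_mem 𝒜 δ _) hδ
  have huc : ((u⁻¹ : Eˣ) : E) ∈ Subring.center E :=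
    center_inv_mem u (by rw [hu]; exact proj_mem_center 𝒜 (t (i₀, j₀)).2 δ)
  have hsum' : ∑ j ∈ s.image Prod.snd, ∑ i ∈ s.image Prod.fst,
      (t (i, j) : E) * ((m i : E) * c j) = 0 := by
    rw [← Finset.sum_product_right', ← hsum]
    symm
    refine Finset.sum_subset (fun p hp => ?_) (fun p _ hp => ?_)
    · exact Finset.mem_product.mpr ⟨Finset.mem_image_of_mem _ hp, Finset.mem_image_of_mem _ hp⟩
    · rw [hts p hp, zero_smul]
  have h1 := congrArg (GradedRing.proj 𝒜 (δ + g j₀)) hsum'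
  have hdeg : ∀ i j, (m i : E) * c j ∈ 𝒜 (g j) := fun i j => by
    have := SetLike.GradedMul.mul_mem (show (m i : E) ∈ 𝒜 0 from (m i).2) (hc j)
    rwa [zero_add] at this
  have hmem : (i₀, j₀) ∈ s := by
    by_contra h
    exact hp (hts _ h)
  rw [map_zero, map_sum, Finset.sum_eq_single j₀] at h1
  · rw [map_sum] at h1
    have h0 : ∀ i, GradedRing.proj 𝒜 (δ + g j₀) ((t (i, j₀) : E) * ((m i : E) * c j₀))
        = GradedRing.proj 𝒜 δ (t (i, j₀)) * m i * c j₀ := fun i => by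
      rw [proj_mul_right 𝒜 _ (hdeg i j₀), add_sub_cancel_right, mul_assoc]
    rw [Finset.sum_congr rfl fun i _ => h0 i, ← Finset.sum_mul, Units.mul_left_eq_zero] at h1
    have hz : ∀ i, ((u⁻¹ : Eˣ) : E) * GradedRing.proj 𝒜 δ (t (i, j₀)) ∈ 𝒜 0 := fun i => by
      have := SetLike.GradedMul.mul_mem hui (proj_mem 𝒜 δ (t (i, j₀) : E))
      rwa [neg_add_cancel] at this
    have h2 := (linearIndependent_iff'.mp hm) (s.image Prod.fst)
      (fun i => toBaseZero 𝒜 _ (hz i) (mul_mem huc (proj_mem_center 𝒜 (t (i, j₀)).2 δ))) (by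
        apply Subtype.ext
        rw [AddSubmonoidClass.coe_finsetSum]
        change ∑ i ∈ s.image Prod.fst,
          (((u⁻¹ : Eˣ) : E) * GradedRing.proj 𝒜 δ (t (i, j₀))) * (m i : E) = 0
        simp only [mul_assoc]
        rw [← Finset.mul_sum, h1, mul_zero]) i₀ (Finset.mem_image_of_mem _ hmem)
    have h3 : ((u⁻¹ : Eˣ) : E) * GradedRing.proj 𝒜 δ (t (i₀, j₀)) = 0 :=
      congrArg (fun z => (((z : baseZero 𝒜) : centerZero 𝒜) : degZero 𝒜).1) h2
    rw [Units.mul_right_eq_zero] at h3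
    exact hδ h3
  · intro j _ hj
    rw [map_sum]
    refine Finset.sum_eq_zero fun i _ => ?_
    rw [proj_mul_right 𝒜 _ (hdeg i j)]
    by_contra hne
    apply hj
    symm
    apply hg
    refine ⟨GradedRing.proj 𝒜 (δ + g j₀ - g j) (t (i, j)) * ((u⁻¹ : Eˣ) : E), ?_, ?_, ?_⟩
    · have := SetLike.GradedMul.mul_mem (proj_mem 𝒜 (δ + g j₀ - g j) (t (i, j) : E)) hui
      rwa [show δ + g j₀ - g j + -δ = g j₀ - g j by abel] at this
    · exact mul_mem (proj_mem_center 𝒜 (t (i, j)).2 _) huc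
    · intro h
      rw [Units.mul_left_eq_zero] at h
      exact hne (by rw [h, zero_mul])
  · intro h
    exact absurd (Finset.mem_image_of_mem _ hmem) h

variable [Module.Finite (Subring.center E) E]

instance finite_base_degZero : Module.Finite (baseZero 𝒜) (degZero 𝒜) := by
  have := hE.nontrivial
  let b := Module.Free.chooseBasis (baseZero 𝒜) (degZero 𝒜)
  have h := linearIndependent_mul_units b.linearIndependent (fun _ : Unit => 1) (fun _ => 0)
    (fun _ => SetLike.GradedOne.one_mem) (fun _ _ _ => rfl)
  have hfin := h.finite
  have : Finite (Module.Free.ChooseBasisIndex (baseZero 𝒜) (degZero 𝒜)) :=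
    Finite.of_injective (fun i => (i, ())) fun i j h => (Prod.ext_iff.mp h).1
  exact Module.Finite.of_basis b

instance finite_center_degZero : Module.Finite (centerZero 𝒜) (degZero 𝒜) :=
  Module.Finite.of_restrictScalars_finite (baseZero 𝒜) _ _

instance finite_base_centerZero : Module.Finite (baseZero 𝒜) (centerZero 𝒜) := by
  let := (isField_baseZero 𝒜).toField
  let f : centerZero 𝒜 →ₗ[baseZero 𝒜] degZero 𝒜 :=
    { toFun := fun x => x
      map_add' := fun _ _ => rfl
      map_smul' := fun _ _ => rfl }
  have : IsNoetherian (baseZero 𝒜) (degZero 𝒜) := isNoetherian_of_isNoetherianRing_of_finite _ _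
  exact Module.Finite.of_injective f Subtype.val_injective

end DegZero

/-! ### The reduced norm on the degree zero part -/

section Tower

variable {Γ : Type v} [AddCommGroup Γ] [DecidableEq Γ] {E : Type u} [Ring E]
variable {𝒜 : Γ → AddSubgroup E} [GradedRing 𝒜] [hE : IsGradedDivisionRing 𝒜]

omit hE in
/-- A maximal subfield `H₀` of `E₀` is the degree zero part of every maximal graded subfield
containing it. -/
theorem MaxCommHomog.mem_alg_of_degZero (H₀ : MaxCommHomog (trivialGrading (degZero 𝒜)))
    (H : MaxCommHomog 𝒜) (hsub : ∀ x ∈ H₀.carrier, (x : E) ∈ H.carrier) (x : degZero 𝒜) :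
    x ∈ H₀.alg ↔ (x : E) ∈ H.alg := by
  constructor
  · intro hx
    exact H.mem_alg_of_mem (hsub x (H₀.mem_carrier (γ := ()) (AddSubgroup.mem_top _) hx))
  · intro hx
    rw [mem_alg]
    exact fun h hh => Subtype.ext (H.mem_alg.mp hx h (hsub h hh))

/-- A maximal graded subfield `L` has a basis over `T` consisting of the products of a basis of
`L₀` over `T₀` with representatives of `Γ_L / Γ_T`. -/
theorem MaxCommHomog.exists_tower_basis (H₀ : MaxCommHomog (trivialGrading (degZero 𝒜)))
    (H : MaxCommHomog 𝒜) (hsub : ∀ x ∈ H₀.carrier, (x : E) ∈ H.carrier)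
    {ι : Type*} [Fintype ι] (m : Module.Basis ι (baseZero 𝒜) H₀.alg) :
    ∃ (κ : Type v) (c : κ → Eˣ) (b : Module.Basis (ι × κ) (Subring.center E) H.alg),
      ∀ i j, (b (i, j) : E) = ((m i : degZero 𝒜) : E) * c j := by
  have := hE.nontrivial
  let κ := {q : Γ ⧸ gradeGroupCenter 𝒜 // ∃ γ, ∃ x ∈ 𝒜 γ, x ∈ H.alg ∧ x ≠ 0 ∧ (γ : Γ ⧸ _) = q}
  have hκ : ∀ q : κ, ∃ (c : Eˣ) (g : Γ), (c : E) ∈ 𝒜 g ∧ (c : E) ∈ H.alg ∧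
      ((g : Γ) : Γ ⧸ gradeGroupCenter 𝒜) = q.1 := by
    rintro ⟨q, γ, x, hx, hxH, hx0, hq⟩
    obtain ⟨w, rfl, -⟩ := isUnit_of_graded 𝒜 hx hx0
    exact ⟨w, γ, hx, hxH, hq⟩
  choose c g hcg hcH hq using hκ
  have hm : LinearIndependent (baseZero 𝒜) fun i => (m i : degZero 𝒜) := by
    let f : H₀.alg →ₗ[baseZero 𝒜] degZero 𝒜 :=
      { toFun := fun x => x
        map_add' := fun _ _ => rfl
        map_smul' := fun _ _ => rfl }
    exact m.linearIndependent.map' f (LinearMap.ker_eq_bot.mpr Subtype.val_injective)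
  have hli := linearIndependent_mul_units hm c g hcg (by
    intro j j' h
    apply Subtype.ext
    rw [← hq j, ← hq j', ← sub_eq_zero, ← QuotientAddGroup.mk_sub]
    exact (QuotientAddGroup.eq_zero_iff _).mpr h)
  let F : ι × κ → H.alg := fun p => ⟨(m p.1 : degZero 𝒜) * c p.2,
    mul_mem ((H₀.mem_alg_of_degZero H hsub _).mp (m p.1).2) (hcH p.2)⟩
  have hF : LinearIndependent (Subring.center E) F :=
    LinearIndependent.of_comp H.alg.val.toLinearMap hli
  have hspan : ⊤ ≤ Submodule.span (Subring.center E) (Set.range F) := by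
    rintro x -
    have key : (x : E) ∈ ((Submodule.span (Subring.center E) (Set.range F)).map
        H.alg.val.toLinearMap).toAddSubgroup := by
      refine mem_of_proj_mem 𝒜 fun γ => ?_
      by_cases h0 : GradedRing.proj 𝒜 γ (x : E) = 0
      · rw [h0]
        exact zero_mem _
      have hmem := proj_mem 𝒜 γ (x : E)
      have hH := H.proj_mem_alg x.2 γ
      generalize GradedRing.proj 𝒜 γ (x : E) = y at h0 hmem hH
      let q : κ := ⟨(γ : Γ ⧸ gradeGroupCenter 𝒜), γ, y, hmem, hH, h0, rfl⟩
      -- write `y = t * z * c q` with `t` central and `z` of degree zero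
      obtain ⟨t, ht, htc, ht0⟩ : γ - g q ∈ gradeGroupCenter 𝒜 := by
        rw [← QuotientAddGroup.eq_zero_iff, QuotientAddGroup.mk_sub, hq q, sub_self]
      obtain ⟨w, rfl, hwi⟩ := isUnit_of_graded 𝒜 ht ht0
      have hz : ((w⁻¹ : Eˣ) : E) * y * (((c q)⁻¹ : Eˣ) : E) ∈ 𝒜 0 := by
        have := SetLike.GradedMul.mul_mem (SetLike.GradedMul.mul_mem hwi hmem)
          (inv_mem_graded 𝒜 (c q) (hcg q))
        rwa [show -(γ - g q) + γ + -g q = 0 by abel] at this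
      have hzH : ((w⁻¹ : Eˣ) : E) * y * (((c q)⁻¹ : Eˣ) : E) ∈ H.alg :=
        mul_mem (mul_mem (H.center_le_alg (center_inv_mem w htc)) hH)
          (H.units_inv_mem_alg _ (hcH q))
      let z : H₀.alg := ⟨⟨_, hz⟩, (H₀.mem_alg_of_degZero H hsub ⟨_, hz⟩).mpr hzH⟩
      have hyz : y = (w : E) * ((z : degZero 𝒜) : E) * c q := by
        simp [z, mul_assoc]
      have hzs : ((z : degZero 𝒜) : E)
          = ∑ i, (baseToCenter 𝒜 (m.repr z i) : E) * ((m i : degZero 𝒜) : E) := by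
        conv_lhs => rw [← m.sum_repr z]
        rw [AddSubmonoidClass.coe_finsetSum, AddSubmonoidClass.coe_finsetSum]
        rfl
      refine ⟨∑ i, ((⟨w, htc⟩ : Subring.center E) * baseToCenter 𝒜 (m.repr z i)) • F (i, q),
        Submodule.sum_mem _ fun i _ =>
          Submodule.smul_mem _ _ (Submodule.subset_span ⟨_, rfl⟩), ?_⟩
      rw [map_sum, hyz, hzs, Finset.mul_sum, Finset.sum_mul]
      refine Finset.sum_congr rfl fun i _ => ?_
      change (w : E) * (baseToCenter 𝒜 (m.repr z i) : E) * (((m i : degZero 𝒜) : E) * c q) = _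
      simp only [mul_assoc]
    obtain ⟨y, hy, hyx⟩ := key
    rwa [← show y = x from Subtype.ext hyx]
  exact ⟨κ, c, Module.Basis.mk hF hspan, fun i j => by rw [Module.Basis.mk_apply]⟩

variable (𝒜) in
omit hE in
/-- Compatible maximal subfields of `E₀` and `E` through given commuting elements of `E₀`. -/
theorem exists_compatible_maxCommHomog (S : Set (degZero 𝒜))
    (hS : ∀ x ∈ S, ∀ y ∈ S, x * y = y * x) :
    ∃ (H₀ : MaxCommHomog (trivialGrading (degZero 𝒜))) (H : MaxCommHomog 𝒜), S ⊆ H₀.carrier ∧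
      ∀ x ∈ H₀.carrier, (x : E) ∈ H.carrier := by
  obtain ⟨H₀, h₀⟩ := exists_maxCommHomog (trivialGrading (degZero 𝒜)) S
    (fun x _ => ⟨(), AddSubgroup.mem_top _⟩) hS
  obtain ⟨H, h⟩ := exists_maxCommHomog 𝒜 ((fun x : degZero 𝒜 => (x : E)) '' H₀.carrier)
    (by
      rintro _ ⟨x, -, rfl⟩
      exact ⟨0, x.2⟩)
    (by
      rintro _ ⟨x, hx, rfl⟩ _ ⟨y, hy, rfl⟩
      exact congrArg Subtype.val (H₀.comm x hx y hy))
  exact ⟨H₀, H, h₀, fun x hx => h ⟨x, hx, rfl⟩⟩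

variable [Module.Finite (Subring.center E) E]

instance MaxCommHomog.finite_base_alg (H₀ : MaxCommHomog (trivialGrading (degZero 𝒜))) :
    Module.Finite (baseZero 𝒜) H₀.alg :=
  Module.Finite.trans (centerZero 𝒜) _

/-- The rank and the norm of a maximal graded subfield, in terms of its degree zero part. -/
theorem MaxCommHomog.exists_norm_eq_pow (H₀ : MaxCommHomog (trivialGrading (degZero 𝒜)))
    (H : MaxCommHomog 𝒜) (hsub : ∀ x ∈ H₀.carrier, (x : E) ∈ H.carrier) :
    ∃ e : ℕ, Module.finrank (Subring.center E) H.alg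
        = Module.finrank (baseZero 𝒜) H₀.alg * e ∧
      ∀ (y : H₀.alg) (hy : ((y : degZero 𝒜) : E) ∈ H.alg),
        Algebra.norm (Subring.center E) (⟨_, hy⟩ : H.alg)
          = baseToCenter 𝒜 (Algebra.norm (baseZero 𝒜) y) ^ e := by
  classical
  have := hE.nontrivial
  have : Nontrivial (baseZero 𝒜) := (isField_baseZero 𝒜).nontrivial
  let m := Module.Free.chooseBasis (baseZero 𝒜) H₀.alg
  obtain ⟨κ, c, b, hb⟩ := H₀.exists_tower_basis H hsub m
  have hfin : Finite (_ × κ) := Module.Finite.finite_basis b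
  have hne := m.index_nonempty
  have : Finite κ := Finite.prod_right (Module.Free.ChooseBasisIndex (baseZero 𝒜) H₀.alg)
  have := Fintype.ofFinite κ
  refine ⟨Fintype.card κ, ?_, fun y hy => ?_⟩
  · rw [Module.finrank_eq_card_basis b, Module.finrank_eq_card_basis m, Fintype.card_prod]
  · rw [Algebra.norm_apply, Algebra.norm_apply, ← LinearMap.det_toMatrix m, RingHom.map_det]
    have h : ∀ i, y * m i = ∑ i', (LinearMap.toMatrix m m (Algebra.lmul (baseZero 𝒜) H₀.alg y)) i' i
        • m i' := by
      intro i
      conv_lhs => rw [← m.sum_repr (y * m i)]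
      simp [LinearMap.toMatrix_apply]
    generalize LinearMap.toMatrix m m (Algebra.lmul (baseZero 𝒜) H₀.alg y) = A at h ⊢
    have h' : ∀ i, ((y : degZero 𝒜) : E) * ((m i : degZero 𝒜) : E)
        = ∑ i', (baseToCenter 𝒜 (A i' i) : E) * ((m i' : degZero 𝒜) : E) := by
      intro i
      have := congrArg (fun z : H₀.alg => ((z : degZero 𝒜) : E)) (h i)
      simp only [AddSubmonoidClass.coe_finsetSum] at this
      exact this
    refine LinearMap.det_eq_pow_of_blocks b _ _ fun i j => Subtype.ext ?_
    rw [AddSubmonoidClass.coe_finsetSum]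
    calc ((y : degZero 𝒜) : E) * (b (i, j) : E)
        = ∑ i', (baseToCenter 𝒜 (A i' i) : E) * (b (i', j) : E) := by
          simp only [hb]
          rw [← mul_assoc, h', Finset.sum_mul]
          exact Finset.sum_congr rfl fun i' _ => mul_assoc _ _ _
      _ = _ := rfl

theorem MaxCommHomog.finrank_base_eq (H₀ : MaxCommHomog (trivialGrading (degZero 𝒜))) :
    Module.finrank (baseZero 𝒜) H₀.alg
      = algIndex (degZero 𝒜) * Module.finrank (baseZero 𝒜) (centerZero 𝒜) := by
  have : Nontrivial (baseZero 𝒜) := (isField_baseZero 𝒜).nontrivial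
  have : Nontrivial (centerZero 𝒜) := (isField_centerZero 𝒜).nontrivial
  rw [H₀.algIndex_eq, mul_comm]
  exact (Module.finrank_mul_finrank (baseZero 𝒜) (centerZero 𝒜) H₀.alg).symm

variable (𝒜) in
theorem algIndex_degZero_mul_pos :
    0 < algIndex (degZero 𝒜) * Module.finrank (baseZero 𝒜) (centerZero 𝒜) := by
  have : Nontrivial (baseZero 𝒜) := (isField_baseZero 𝒜).nontrivial
  have : Nontrivial (centerZero 𝒜) := (isField_centerZero 𝒜).nontrivial
  let b := Module.Free.chooseBasis (baseZero 𝒜) (centerZero 𝒜)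
  have := b.index_nonempty
  refine Nat.mul_pos (algIndex_pos_of_graded (trivialGrading (degZero 𝒜))) ?_
  rw [Module.finrank_eq_card_basis b]
  exact Fintype.card_pos

theorem MaxCommHomog.finrank_eq_deltaE_mul (H₀ : MaxCommHomog (trivialGrading (degZero 𝒜)))
    (H : MaxCommHomog 𝒜) {e : ℕ} (he : Module.finrank (Subring.center E) H.alg
        = Module.finrank (baseZero 𝒜) H₀.alg * e) : deltaE 𝒜 = e := by
  rw [deltaE, H.algIndex_eq, he, H₀.finrank_base_eq]
  exact Nat.mul_div_cancel_left _ (algIndex_degZero_mul_pos 𝒜)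

variable (𝒜) in
theorem deltaE_mul :
    deltaE 𝒜 * (algIndex (degZero 𝒜) * Module.finrank (baseZero 𝒜) (centerZero 𝒜))
      = algIndex E := by
  obtain ⟨H₀, H, -, hsub⟩ := exists_compatible_maxCommHomog 𝒜 ∅ (by simp)
  obtain ⟨e, he, -⟩ := H₀.exists_norm_eq_pow H hsub
  rw [H₀.finrank_eq_deltaE_mul H he, H.algIndex_eq, he, H₀.finrank_base_eq, mul_comm]

variable [IsAddTorsionFree Γ]

/-- The reduced norm of `E` on `E₀` is the `δ`-th power of `N ∘ Nrd`. -/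
theorem reducedNorm_degZero (a : degZero 𝒜) :
    reducedNorm E (a : E) = baseToCenter 𝒜
      (Algebra.norm (baseZero 𝒜) (reducedNorm (degZero 𝒜) a)) ^ deltaE 𝒜 := by
  obtain ⟨H₀, H, ha, hsub⟩ := exists_compatible_maxCommHomog 𝒜 {a} (by simp)
  obtain ⟨e, he, hnorm⟩ := H₀.exists_norm_eq_pow H hsub
  have ha' : a ∈ H₀.alg := H₀.mem_alg_of_mem (ha rfl)
  have haE : (a : E) ∈ H.alg := (H₀.mem_alg_of_degZero H hsub a).mp ha'
  have h1 := H.reducedNorm_eq_norm ⟨a, haE⟩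
  have h2 := H₀.reducedNorm_eq_norm ⟨a, ha'⟩
  have h3 : Algebra.norm (baseZero 𝒜) (Algebra.norm (centerZero 𝒜) (⟨a, ha'⟩ : H₀.alg))
      = Algebra.norm (baseZero 𝒜) (⟨a, ha'⟩ : H₀.alg) := Algebra.norm_norm
  change reducedNorm E (a : E) = _ at h1
  change reducedNorm (degZero 𝒜) a = _ at h2
  rw [h1, h2, h3, H₀.finrank_eq_deltaE_mul H he]
  exact hnorm ⟨a, ha'⟩ haE

end Tower

/-! ### Galois descent for the center of the degree zero part -/

section FieldGalois

/-- A group of automorphisms of a finite field extension with fixed field the base field is the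
whole Galois group, and the norm is the product over it. -/
theorem IsField.galois_of_fixed {K L : Type*} [CommRing K] [CommRing L] [Algebra K L]
    (hK : IsField K) (hL : IsField L) [Module.Finite K L] (S : Subgroup (L ≃ₐ[K] L))
    (hS : ∀ x : L, (∀ g ∈ S, g x = x) → x ∈ Set.range (algebraMap K L)) :
    S = ⊤ ∧ Finite (L ≃ₐ[K] L) ∧
      ∀ x : L, algebraMap K L (Algebra.norm K x) = ∏ᶠ g : L ≃ₐ[K] L, g x := by
  let := hK.toField
  let := hL.toField
  have hbot : IntermediateField.fixedField S = ⊥ := by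
    rw [eq_bot_iff]
    intro x hx
    rw [IntermediateField.mem_fixedField_iff] at hx
    exact IntermediateField.mem_bot.mpr (hS x hx)
  have htop : S = ⊤ := by
    rw [← IntermediateField.fixingSubgroup_fixedField S, hbot,
      IntermediateField.fixingSubgroup_bot]
  have : IsGalois K L := IsGalois.of_fixedField_eq_bot K L (by rw [← htop, hbot])
  refine ⟨htop, inferInstance, fun x => ?_⟩
  rw [finprod_eq_prod_of_fintype]
  exact Algebra.norm_eq_prod_automorphisms K x

end FieldGalois

section NrdEquivariant

variable {A : Type u} [Ring A]

/-- The image of a maximal commuting set under an automorphism. -/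
def MaxCommHomog.map (H : MaxCommHomog (trivialGrading A)) (σ : A ≃+* A) :
    MaxCommHomog (trivialGrading A) where
  carrier := σ '' H.carrier
  homog _ _ := ⟨(), AddSubgroup.mem_top _⟩
  comm := by
    rintro _ ⟨x, hx, rfl⟩ _ ⟨y, hy, rfl⟩
    rw [← map_mul, H.comm x hx y hy, map_mul]
  maximal _ x _ h := by
    refine ⟨σ.symm x, H.maximal () _ (AddSubgroup.mem_top _) fun y hy => ?_, by simp⟩
    apply σ.injective
    simpa using h (σ y) ⟨y, hy, rfl⟩

theorem MaxCommHomog.mem_map_alg (H : MaxCommHomog (trivialGrading A)) (σ : A ≃+* A) (x : A) :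
    σ x ∈ (H.map σ).alg ↔ x ∈ H.alg := by
  rw [mem_alg, mem_alg]
  constructor
  · intro h y hy
    apply σ.injective
    simpa using h (σ y) ⟨y, hy, rfl⟩
  · rintro h _ ⟨y, hy, rfl⟩
    rw [← map_mul, h y hy, map_mul]

/-- The reduced norm of a division ring commutes with ring automorphisms. -/
theorem reducedNorm_ringEquiv [IsGradedDivisionRing (trivialGrading A)]
    [Module.Finite (Subring.center A) A] (σ : A ≃+* A) (a : A) :
    reducedNorm A (σ a) = Subring.centerCongr σ (reducedNorm A a) := by
  obtain ⟨H, ha⟩ := exists_maxCommHomog (trivialGrading A) {a}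
    (fun _ _ => ⟨(), AddSubgroup.mem_top _⟩) (by simp)
  have haH : a ∈ H.alg := H.mem_alg_of_mem (ha rfl)
  have haH' : σ a ∈ (H.map σ).alg := (H.mem_map_alg σ a).mpr haH
  have h1 := H.reducedNorm_eq_norm ⟨a, haH⟩
  have h2 := (H.map σ).reducedNorm_eq_norm ⟨σ a, haH'⟩
  let e : H.alg ≃+* (H.map σ).alg :=
    { toFun := fun x => ⟨σ x, (H.mem_map_alg σ x).mpr x.2⟩
      invFun := fun x => ⟨σ.symm x, (H.mem_map_alg σ _).mp (by simp)⟩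
      left_inv := fun x => Subtype.ext (by simp)
      right_inv := fun x => Subtype.ext (by simp)
      map_mul' := fun x y => Subtype.ext (by simp)
      map_add' := fun x y => Subtype.ext (by simp) }
  have h3 := Algebra.norm_eq_of_equiv_equiv (Subring.centerCongr σ) e
    (by ext x; rfl) (⟨a, haH⟩ : H.alg)
  change reducedNorm A a = _ at h1
  change reducedNorm A (σ a) = _ at h2
  rw [h1, h2, h3, RingEquiv.apply_symm_apply]
  rfl

end NrdEquivariant

section Conj

variable {Γ : Type v} [AddCommGroup Γ] [IsAddTorsionFree Γ] [DecidableEq Γ] {E : Type u} [Ring E]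
variable (𝒜 : Γ → AddSubgroup E) [GradedRing 𝒜] [hE : IsGradedDivisionRing 𝒜]

theorem conj_mem_degZero (b : Eˣ) {x : E} (hx : x ∈ degZero 𝒜) :
    (b : E) * x * ((b⁻¹ : Eˣ) : E) ∈ degZero 𝒜 := by
  obtain ⟨γ, hγ⟩ := exists_mem_of_unit 𝒜 b
  have h := SetLike.GradedMul.mul_mem (SetLike.GradedMul.mul_mem hγ (show x ∈ 𝒜 0 from hx))
    (inv_mem_graded 𝒜 b hγ)
  rwa [add_zero, add_neg_cancel] at h

/-- Conjugation by a unit of `E` on `E₀`. -/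
def conjDegZero (b : Eˣ) : degZero 𝒜 ≃+* degZero 𝒜 where
  toFun x := ⟨b * x * ((b⁻¹ : Eˣ) : E), conj_mem_degZero 𝒜 b x.2⟩
  invFun x := ⟨((b⁻¹ : Eˣ) : E) * x * b, by
    have := conj_mem_degZero 𝒜 b⁻¹ x.2
    rwa [inv_inv] at this⟩
  left_inv x := Subtype.ext (by simp [mul_assoc])
  right_inv x := Subtype.ext (by simp [mul_assoc])
  map_mul' x y := Subtype.ext (by simp [mul_assoc])
  map_add' x y := Subtype.ext (by simp [mul_add, add_mul])

/-- Conjugation by units of `E` as a homomorphism to `Gal(Z(E₀)/T₀)`. -/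
def conjGal : Eˣ →* galZero 𝒜 where
  toFun b := AlgEquiv.ofRingEquiv (f := Subring.centerCongr (conjDegZero 𝒜 b)) (by
    intro t
    apply Subtype.ext
    apply Subtype.ext
    change (b : E) * (baseToCenter 𝒜 t : E) * ((b⁻¹ : Eˣ) : E) = (baseToCenter 𝒜 t : E)
    rw [Subring.mem_center_iff.mp (baseToCenter 𝒜 t).2 b, mul_assoc, Units.mul_inv, mul_one])
  map_one' := by
    ext x
    change (1 : E) * ((x : degZero 𝒜) : E) * ((1⁻¹ : Eˣ) : E) = ((x : degZero 𝒜) : E)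
    simp
  map_mul' a b := by
    ext x
    change ((a * b : Eˣ) : E) * ((x : degZero 𝒜) : E) * (((a * b)⁻¹ : Eˣ) : E)
      = (a : E) * ((b : E) * ((x : degZero 𝒜) : E) * ((b⁻¹ : Eˣ) : E)) * ((a⁻¹ : Eˣ) : E)
    simp [mul_assoc]

theorem coe_conjGal (b : Eˣ) (x : centerZero 𝒜) :
    ((conjGal 𝒜 b x : degZero 𝒜) : E) = b * ((x : degZero 𝒜) : E) * ((b⁻¹ : Eˣ) : E) := rfl

/-- The elements of `Z(E₀)` fixed by all conjugations are those of `T₀`. -/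
theorem mem_baseZero_of_conjGal (x : centerZero 𝒜) (h : ∀ b : Eˣ, conjGal 𝒜 b x = x) :
    x ∈ baseZero 𝒜 := by
  change ((x : degZero 𝒜) : E) ∈ Subring.center E
  rw [Subring.mem_center_iff]
  refine commute_of_commute_homogeneous 𝒜 fun γ b hb => ?_
  by_cases hb0 : b = 0
  · simp [hb0]
  obtain ⟨w, rfl, -⟩ := isUnit_of_graded 𝒜 hb hb0
  have := congrArg (fun z : centerZero 𝒜 => ((z : degZero 𝒜) : E)) (h w)
  simp only [coe_conjGal] at this
  conv_rhs => rw [← this]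
  rw [mul_assoc _ _ (w : E), Units.inv_mul, mul_one]

variable [Module.Finite (Subring.center E) E]

theorem galZero_galois : (conjGal 𝒜).range = ⊤ ∧ Finite (galZero 𝒜) ∧
    ∀ x : centerZero 𝒜, algebraMap (baseZero 𝒜) _ (Algebra.norm (baseZero 𝒜) x)
      = ∏ᶠ g : galZero 𝒜, g x := by
  refine IsField.galois_of_fixed (isField_baseZero 𝒜) (isField_centerZero 𝒜) _ fun x hx => ?_
  exact ⟨⟨x, mem_baseZero_of_conjGal 𝒜 x fun b => hx _ ⟨b, rfl⟩⟩, rfl⟩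

/-- Every element of `Gal(Z(E₀)/T₀)` is a conjugation. -/
theorem conjGal_surjective : Function.Surjective (conjGal 𝒜) :=
  MonoidHom.range_eq_top.mp (galZero_galois 𝒜).1

instance finite_galZero : Finite (galZero 𝒜) := (galZero_galois 𝒜).2.1

omit [Module.Finite (Subring.center E) E] in
theorem isGaloisGroup_galZero : IsGaloisGroup (galZero 𝒜) (baseZero 𝒜) (centerZero 𝒜) where
  faithful := inferInstance
  commutes := inferInstance
  isInvariant := ⟨fun x hx =>
    ⟨⟨x, mem_baseZero_of_conjGal 𝒜 x fun b => hx (conjGal 𝒜 b)⟩, rfl⟩⟩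

/-! ### Reduced norms of conjugates, commutators and units -/

/-- Conjugation by a unit of `E` on `E₀^*`. -/
def conjUnits (b : Eˣ) : (degZero 𝒜)ˣ →* (degZero 𝒜)ˣ :=
  Units.map (conjDegZero 𝒜 b : degZero 𝒜 →* degZero 𝒜)

omit [Module.Finite (Subring.center E) E] in
theorem unitsIncl_conjUnits (b : Eˣ) (x : (degZero 𝒜)ˣ) :
    unitsIncl 𝒜 (conjUnits 𝒜 b x) = b * unitsIncl 𝒜 x * b⁻¹ := Units.ext rfl

theorem unitsNrd_conjUnits (b : Eˣ) (x : (degZero 𝒜)ˣ) :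
    unitsNrd (degZero 𝒜) (conjUnits 𝒜 b x)
      = Units.map (conjGal 𝒜 b : centerZero 𝒜 →* centerZero 𝒜) (unitsNrd (degZero 𝒜) x) :=
  Units.ext (reducedNorm_ringEquiv (conjDegZero 𝒜 b) (x : degZero 𝒜))

theorem tildeN_conjUnits (b : Eˣ) (x : (degZero 𝒜)ˣ) :
    tildeN 𝒜 (conjUnits 𝒜 b x) = tildeN 𝒜 x := by
  apply Units.ext
  change Algebra.norm (baseZero 𝒜) ((unitsNrd (degZero 𝒜) (conjUnits 𝒜 b x) : (centerZero 𝒜)ˣ) :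
    centerZero 𝒜) = Algebra.norm (baseZero 𝒜) ((unitsNrd (degZero 𝒜) x : (centerZero 𝒜)ˣ) :
    centerZero 𝒜)
  rw [unitsNrd_conjUnits]
  exact Algebra.norm_eq_of_algEquiv (conjGal 𝒜 b) _

theorem unitsNrd_unitsIncl (x : (degZero 𝒜)ˣ) :
    unitsNrd E (unitsIncl 𝒜 x)
      = Units.map (baseToCenter 𝒜 : baseZero 𝒜 →* Subring.center E) (tildeN 𝒜 x ^ deltaE 𝒜) := by
  apply Units.ext
  rw [map_pow]
  exact reducedNorm_degZero (x : degZero 𝒜)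

omit [Module.Finite (Subring.center E) E] [IsAddTorsionFree Γ] hE in
theorem unitsMap_baseToCenter_injective : Function.Injective
    (Units.map (baseToCenter 𝒜 : baseZero 𝒜 →* Subring.center E)) :=
  Units.map_injective (baseToCenter_injective 𝒜)

omit [Module.Finite (Subring.center E) E] [IsAddTorsionFree Γ] hE in
theorem unitsIncl_injective : Function.Injective (unitsIncl 𝒜) :=
  Units.map_injective Subtype.val_injective

theorem unitsIncl_mem_normOne_iff (x : (degZero 𝒜)ˣ) :
    unitsIncl 𝒜 x ∈ normOne E ↔ tildeN 𝒜 x ^ deltaE 𝒜 = 1 := by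
  rw [normOne, MonoidHom.mem_ker, unitsNrd_unitsIncl,
    map_eq_one_iff _ (unitsMap_baseToCenter_injective 𝒜)]

omit [Module.Finite (Subring.center E) E] in
/-- `[E₀^*, E^*]` inside `E₀^*`, through its generators `a * (b * a * b⁻¹)⁻¹`. -/
theorem mixedCommZero_eq_closure : mixedCommZero 𝒜
    = Subgroup.closure {y | ∃ (a : (degZero 𝒜)ˣ) (b : Eˣ), y = a * (conjUnits 𝒜 b a)⁻¹} := by
  have hmap : mixedComm 𝒜 = (Subgroup.closure
      {y | ∃ (a : (degZero 𝒜)ˣ) (b : Eˣ), y = a * (conjUnits 𝒜 b a)⁻¹}).map (unitsIncl 𝒜) := by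
    rw [MonoidHom.map_closure, mixedComm, Subgroup.commutator_def]
    congr 1
    ext z
    constructor
    · rintro ⟨_, ⟨a, rfl⟩, b, -, rfl⟩
      refine ⟨_, ⟨a, b, rfl⟩, ?_⟩
      rw [map_mul, map_inv, unitsIncl_conjUnits, commutatorElement_def]
      group
    · rintro ⟨_, ⟨a, b, rfl⟩, rfl⟩
      refine ⟨_, ⟨a, rfl⟩, b, Subgroup.mem_top b, ?_⟩
      rw [map_mul, map_inv, unitsIncl_conjUnits, commutatorElement_def]
      group
  rw [mixedCommZero, hmap, Subgroup.comap_map_eq_self_of_injective (unitsIncl_injective 𝒜)]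

theorem mixedCommZero_le_ker : mixedCommZero 𝒜 ≤ (tildeN 𝒜).ker := by
  rw [mixedCommZero_eq_closure, Subgroup.closure_le]
  rintro _ ⟨a, b, rfl⟩
  change tildeN 𝒜 _ = 1
  rw [map_mul, map_inv, tildeN_conjUnits, mul_inv_cancel]

omit [Module.Finite (Subring.center E) E] [IsAddTorsionFree Γ] hE in
theorem mixedComm_le_commutator : mixedComm 𝒜 ≤ commutator Eˣ :=
  Subgroup.commutator_mono le_top le_rfl

omit [IsAddTorsionFree Γ] in
/-- Degrees of units are torsion modulo `Γ_T`, because `E` is finite over `T`. -/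
theorem exists_nsmul_mem_gradeGroupCenter {γ : Γ} (w : Eˣ) (hw : (w : E) ∈ 𝒜 γ) :
    ∃ k : ℕ, k ≠ 0 ∧ k • γ ∈ gradeGroupCenter 𝒜 := by
  have := hE.nontrivial
  by_contra! h
  let b := Module.Free.chooseBasis (baseZero 𝒜) (degZero 𝒜)
  have : Nontrivial (baseZero 𝒜) := (isField_baseZero 𝒜).nontrivial
  have hne := b.index_nonempty
  have hli := linearIndependent_mul_units b.linearIndependent (fun j : ℕ => w ^ j)
    (fun j => j • γ) (fun j => by
      rw [Units.val_pow_eq_pow_val]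
      exact SetLike.pow_mem_graded j hw) (by
      intro j j' hj
      by_contra hne
      wlog hlt : j' < j generalizing j j' with key
      · exact key j' j (by simpa using neg_mem hj) (Ne.symm hne) (by omega)
      refine h (j - j') (by omega) ?_
      rwa [sub_nsmul _ hlt.le, ← sub_eq_add_neg])
  have hfin := hli.finite
  have : Finite ℕ := Finite.prod_right (Module.Free.ChooseBasisIndex (baseZero 𝒜) (degZero 𝒜))
  exact not_finite ℕ

/-- Elements of reduced norm `1` have degree `0`: some power is a product of a central unit `t` and
a unit of `E₀`, and then the degree of `t ^ ind(E)` vanishes. -/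
theorem normOne_le_range : normOne E ≤ (unitsIncl 𝒜).range := by
  have := hE.nontrivial
  intro w hw
  obtain ⟨γ, hγ⟩ := exists_mem_of_unit 𝒜 w
  obtain ⟨k, hk, t, ht, htc, ht0⟩ := exists_nsmul_mem_gradeGroupCenter 𝒜 w hγ
  obtain ⟨t, rfl, hti⟩ := isUnit_of_graded 𝒜 ht ht0
  have hx0 : ((t⁻¹ * w ^ k : Eˣ) : E) ∈ 𝒜 0 := by
    have := SetLike.GradedMul.mul_mem hti (SetLike.pow_mem_graded k hγ)
    rwa [neg_add_cancel, ← Units.val_pow_eq_pow_val, ← Units.val_mul] at this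
  have h1 : reducedNorm E ((w ^ k : Eˣ) : E) = 1 := by
    have : unitsNrd E (w ^ k) = 1 := (normOne E).pow_mem hw k
    exact congrArg Units.val this
  have h2 : ((w ^ k : Eˣ) : E) = (t : E) * ((t⁻¹ * w ^ k : Eˣ) : E) := by
    rw [← Units.val_mul, mul_inv_cancel_left]
  rw [h2, map_mul, reducedNorm_center_of_graded 𝒜 ⟨t, htc⟩,
    reducedNorm_degZero (𝒜 := 𝒜) ⟨_, hx0⟩, ← map_pow] at h1
  have h3 := congrArg (fun z : Subring.center E => (z : E)) h1
  simp only [Subring.coe_mul, Subring.coe_pow, Subring.coe_one] at h3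
  have h4 := SetLike.GradedMul.mul_mem (SetLike.pow_mem_graded (algIndex E) ht)
    (show _ ∈ 𝒜 0 from (((Algebra.norm (baseZero 𝒜) (reducedNorm (degZero 𝒜) ⟨_, hx0⟩) ^ deltaE 𝒜 :
      baseZero 𝒜) : centerZero 𝒜) : degZero 𝒜).2)
  rw [coe_baseToCenter] at h3
  rw [h3, add_zero] at h4
  have h5 := DirectSum.degree_eq_of_mem_mem 𝒜 h4 SetLike.GradedOne.one_mem one_ne_zero
  rw [smul_eq_zero_iff_right (algIndex_pos_of_graded 𝒜).ne', smul_eq_zero_iff_right hk] at h5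
  rw [mem_range_unitsIncl]
  rwa [h5] at hγ

end Conj

/-! ### The commutator pairing on grade groups -/

/-- An alternating biadditive map factors through the exterior square. -/
theorem exists_exteriorSquare_lift {A M : Type*} [AddCommGroup A] [AddCommGroup M]
    (B : A →+ A →+ M) (hB : ∀ a, B a a = 0) :
    ∃ L : ⋀[ℤ]^2 A →ₗ[ℤ] M, ∀ a b, L (exteriorPower.ιMulti ℤ 2 ![a, b]) = B a b := by
  let f : A [⋀^Fin 2]→ₗ[ℤ] M :=
    { toFun := fun v => B (v 0) (v 1)
      map_update_add' := by
        intro _ m i x y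
        fin_cases i <;> simp [Function.update]
      map_update_smul' := by
        intro _ m i c x
        fin_cases i <;> simp [Function.update]
      map_eq_zero_of_eq' := by
        intro v i j hij hne
        have : v 0 = v 1 := by
          fin_cases i <;> fin_cases j <;> first | exact absurd rfl hne | exact hij | exact hij.symm
        change B (v 0) (v 1) = 0
        rw [this]
        exact hB _ }
  exact ⟨exteriorPower.alternatingMapLinearEquiv f, fun a b =>
    exteriorPower.alternatingMapLinearEquiv_apply_ιMulti f _⟩

section Pairing

open scoped commutatorElement

variable {Γ : Type v} [AddCommGroup Γ] [IsAddTorsionFree Γ] [DecidableEq Γ] {E : Type u} [Ring E]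
variable (𝒜 : Γ → AddSubgroup E) [GradedRing 𝒜] [hE : IsGradedDivisionRing 𝒜]

omit [IsAddTorsionFree Γ] hE in
theorem commutatorElement_mem_mixedComm_left {a : Eˣ} (ha : a ∈ (unitsIncl 𝒜).range) (b : Eˣ) :
    ⁅a, b⁆ ∈ mixedComm 𝒜 :=
  Subgroup.commutator_mem_commutator ha (Subgroup.mem_top b)

omit [IsAddTorsionFree Γ] hE in
theorem commutatorElement_mem_mixedComm_right (a : Eˣ) {b : Eˣ}
    (hb : b ∈ (unitsIncl 𝒜).range) : ⁅a, b⁆ ∈ mixedComm 𝒜 := by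
  rw [← commutatorElement_inv]
  exact inv_mem (commutatorElement_mem_mixedComm_left 𝒜 hb a)

omit [IsAddTorsionFree Γ] [DecidableEq Γ] [GradedRing 𝒜] hE [AddCommGroup Γ] in
theorem commutatorElement_mem_normOne (a b : Eˣ) : ⁅a, b⁆ ∈ normOne E :=
  commutator_le_normOne E (Subgroup.commutator_mem_commutator (Subgroup.mem_top a)
    (Subgroup.mem_top b))

/-- Commutators of units of `E` lie in `E₀^*`. -/
theorem commutatorElement_mem_range (a b : Eˣ) : ⁅a, b⁆ ∈ (unitsIncl 𝒜).range := by
  rw [mem_range_unitsIncl]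
  obtain ⟨γ, hγ⟩ := exists_mem_of_unit 𝒜 a
  obtain ⟨δ, hδ⟩ := exists_mem_of_unit 𝒜 b
  have h := SetLike.GradedMul.mul_mem (SetLike.GradedMul.mul_mem (SetLike.GradedMul.mul_mem hγ hδ)
    (inv_mem_graded 𝒜 a hγ)) (inv_mem_graded 𝒜 b hδ)
  rwa [show γ + δ + -γ + -δ = 0 by abel] at h

/-- The class of the commutator of two units in `E^(1) / [E₀^*, E^*]`. -/
def commClass (a b : Eˣ) : NormOneQuot 𝒜 :=
  QuotientGroup.mk ⟨⁅a, b⁆, commutatorElement_mem_normOne a b⟩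

theorem commClass_mul_left (a a' b : Eˣ) :
    commClass 𝒜 (a * a') b = commClass 𝒜 a' b * commClass 𝒜 a b := by
  rw [commClass, commClass, commClass, ← QuotientGroup.mk_mul, eq_comm, QuotientGroup.eq,
    Subgroup.mem_subgroupOf]
  -- the difference of the two sides is a conjugate of the commutator of `a` with `⁅a', b⁆ ∈ E₀^*`
  have h := (mixedComm_normal 𝒜).conj_mem _ (commutatorElement_mem_mixedComm_right 𝒜 a
    (commutatorElement_mem_range 𝒜 a' b)) (⁅a', b⁆ * ⁅a, b⁆)⁻¹
  convert h using 1
  simp only [Subgroup.coe_mul, Subgroup.coe_inv, commutatorElement_def]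
  group

theorem commClass_inv (a b : Eˣ) : (commClass 𝒜 a b)⁻¹ = commClass 𝒜 b a := by
  rw [commClass, commClass, ← QuotientGroup.mk_inv]
  congr 1
  exact Subtype.ext (commutatorElement_inv a b)

theorem commClass_eq_one {a : Eˣ} (ha : a ∈ (unitsIncl 𝒜).range) (b : Eˣ) :
    commClass 𝒜 a b = 1 := by
  rw [commClass, QuotientGroup.eq_one_iff, Subgroup.mem_subgroupOf]
  exact commutatorElement_mem_mixedComm_left 𝒜 ha b

theorem commClass_center {a : Eˣ} (ha : (a : E) ∈ Subring.center E) (b : Eˣ) :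
    commClass 𝒜 a b = 1 := by
  rw [commClass, QuotientGroup.eq_one_iff, Subgroup.mem_subgroupOf]
  have h : ⁅a, b⁆ = 1 := by
    rw [commutatorElement_eq_one_iff_mul_comm]
    exact Units.ext (Subring.mem_center_iff.mp ha b).symm
  simp [h]

theorem commClass_self (a : Eˣ) : commClass 𝒜 a a = 1 := by
  rw [commClass, QuotientGroup.eq_one_iff, Subgroup.mem_subgroupOf]
  simp

theorem commClass_congr_left {a a' : Eˣ} {γ γ' : Γ} (ha : (a : E) ∈ 𝒜 γ) (ha' : (a' : E) ∈ 𝒜 γ')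
    (h : γ' - γ ∈ gradeGroupCenter 𝒜) (b : Eˣ) : commClass 𝒜 a' b = commClass 𝒜 a b := by
  obtain ⟨t, ht, htc, ht0⟩ := h
  obtain ⟨t, rfl, hti⟩ := isUnit_of_graded 𝒜 ht ht0
  have hc : t⁻¹ * (a⁻¹ * a') ∈ (unitsIncl 𝒜).range := by
    rw [mem_range_unitsIncl]
    have := SetLike.GradedMul.mul_mem hti
      (SetLike.GradedMul.mul_mem (inv_mem_graded 𝒜 a ha) ha')
    rwa [show -(γ' - γ) + (-γ + γ') = 0 by abel] at this
  have h1 : a' = a * (t * (t⁻¹ * (a⁻¹ * a'))) := by group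
  rw [h1, commClass_mul_left, commClass_mul_left, commClass_eq_one 𝒜 hc, commClass_center 𝒜 htc,
    one_mul, one_mul]

theorem commClass_congr {a a' b b' : Eˣ} {γ γ' δ δ' : Γ} (ha : (a : E) ∈ 𝒜 γ)
    (ha' : (a' : E) ∈ 𝒜 γ') (hb : (b : E) ∈ 𝒜 δ) (hb' : (b' : E) ∈ 𝒜 δ')
    (h : γ' - γ ∈ gradeGroupCenter 𝒜) (h' : δ' - δ ∈ gradeGroupCenter 𝒜) :
    commClass 𝒜 a' b' = commClass 𝒜 a b := by
  rw [commClass_congr_left 𝒜 ha ha' h, ← commClass_inv, commClass_congr_left 𝒜 hb hb' h',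
    commClass_inv]

variable [Module.Finite (Subring.center E) E]

/-- `E^(1) / [E₀^*, E^*]` is commutative, because `E^(1)` lies in `E₀^*`. -/
instance normOneQuotCommGroup : CommGroup (NormOneQuot 𝒜) :=
  { (inferInstance : Group (NormOneQuot 𝒜)) with
    mul_comm := fun x y => by
      induction x using QuotientGroup.induction_on with
      | _ x =>
      induction y using QuotientGroup.induction_on with
      | _ y =>
      rw [← QuotientGroup.mk_mul, ← QuotientGroup.mk_mul, QuotientGroup.eq,
        Subgroup.mem_subgroupOf]
      have h := commutatorElement_mem_mixedComm_left 𝒜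
        (inv_mem (normOne_le_range 𝒜 y.2)) (x : Eˣ)⁻¹
      convert h using 1
      simp only [Subgroup.coe_mul, Subgroup.coe_inv, commutatorElement_def]
      group }

omit [IsAddTorsionFree Γ] [Module.Finite (Subring.center E) E] in
theorem exists_unit_of_gradeQuot (q : GradeQuot 𝒜) : ∃ (w : Eˣ) (γ : gradeGroup 𝒜),
    (w : E) ∈ 𝒜 γ ∧ (QuotientAddGroup.mk γ : GradeQuot 𝒜) = q := by
  obtain ⟨γ, rfl⟩ := QuotientAddGroup.mk_surjective q
  obtain ⟨x, hx, -, hx0⟩ := γ.2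
  obtain ⟨w, rfl, -⟩ := isUnit_of_graded 𝒜 hx hx0
  exact ⟨w, γ, hx, rfl⟩

omit [IsAddTorsionFree Γ] [Module.Finite (Subring.center E) E] in
theorem gradeQuot_mk_eq_iff (γ δ : gradeGroup 𝒜) :
    (QuotientAddGroup.mk γ : GradeQuot 𝒜) = QuotientAddGroup.mk δ
      ↔ (δ : Γ) - γ ∈ gradeGroupCenter 𝒜 := by
  rw [QuotientAddGroup.eq, AddSubgroup.mem_addSubgroupOf, AddSubgroup.coe_add,
    AddSubgroup.coe_neg, neg_add_eq_sub]

/-- The commutator map on the exterior square of `Γ_E / Γ_T`. -/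
theorem exists_commutator_map : ∃ g : Multiplicative (⋀[ℤ]^2 (GradeQuot 𝒜)) →* NormOneQuot 𝒜,
    ∀ (γ δ : gradeGroup 𝒜) (a b : Eˣ), (a : E) ∈ 𝒜 γ → (b : E) ∈ 𝒜 δ →
      g (Multiplicative.ofAdd (exteriorPower.ιMulti ℤ 2
        ![(QuotientAddGroup.mk γ : GradeQuot 𝒜), (QuotientAddGroup.mk δ : GradeQuot 𝒜)]))
        = commClass 𝒜 a b := by
  choose u d hu hd using exists_unit_of_gradeQuot 𝒜
  have hcongr : ∀ {q r : GradeQuot 𝒜} {γ δ : gradeGroup 𝒜} {a b : Eˣ}, (a : E) ∈ 𝒜 γ →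
      (b : E) ∈ 𝒜 δ → QuotientAddGroup.mk γ = q → QuotientAddGroup.mk δ = r →
      commClass 𝒜 (u q) (u r) = commClass 𝒜 a b := by
    rintro q r γ δ a b ha hb rfl rfl
    exact commClass_congr 𝒜 ha (hu _) hb (hu _) ((gradeQuot_mk_eq_iff 𝒜 _ _).mp (hd _).symm)
      ((gradeQuot_mk_eq_iff 𝒜 _ _).mp (hd _).symm)
  have hadd : ∀ q q' r, commClass 𝒜 (u (q + q')) (u r)
      = commClass 𝒜 (u q) (u r) * commClass 𝒜 (u q') (u r) := by
    intro q q' r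
    rw [hcongr (γ := d q + d q') (a := u q * u q')
      (SetLike.GradedMul.mul_mem (hu q) (hu q')) (hu r)
      (by rw [QuotientAddGroup.mk_add, hd, hd]) (hd r), commClass_mul_left, mul_comm]
  have hadd' : ∀ q r r', commClass 𝒜 (u q) (u (r + r'))
      = commClass 𝒜 (u q) (u r) * commClass 𝒜 (u q) (u r') := by
    intro q r r'
    rw [← commClass_inv, hadd, mul_inv, commClass_inv, commClass_inv]
  let B : GradeQuot 𝒜 →+ GradeQuot 𝒜 →+ Additive (NormOneQuot 𝒜) :=
    AddMonoidHom.mk' (fun q => AddMonoidHom.mk'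
      (fun r => Additive.ofMul (commClass 𝒜 (u q) (u r))) fun r r' => by
        rw [hadd', ofMul_mul]) fun q q' => by
      ext r
      change Additive.ofMul (commClass 𝒜 (u (q + q')) (u r)) = _
      rw [hadd, ofMul_mul]
      rfl
  obtain ⟨L, hL⟩ := exists_exteriorSquare_lift B fun q => by
    change Additive.ofMul (commClass 𝒜 (u q) (u q)) = 0
    rw [commClass_self, ofMul_one]
  refine ⟨AddMonoidHom.toMultiplicativeLeft L.toAddMonoidHom, fun γ δ a b ha hb => ?_⟩
  exact (congrArg Additive.toMul (hL _ _)).trans (hcongr ha hb rfl rfl)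

end Pairing

/-! ### Reduced norms and Tate cohomology -/

section TateNrd

variable {Γ : Type v} [AddCommGroup Γ] [IsAddTorsionFree Γ] [DecidableEq Γ] {E : Type u} [Ring E]
variable (𝒜 : Γ → AddSubgroup E) [GradedRing 𝒜] [hE : IsGradedDivisionRing 𝒜]

/-- The scalar multiplication underlying the action of `G` on `Z(E₀)^*`. -/
instance galZeroSMul : SMul (galZero 𝒜) (centerZero 𝒜)ˣ := (galZeroAction 𝒜).toSMul

variable [Module.Finite (Subring.center E) E]

theorem isStableSubgroup_nrdImage : IsStableSubgroup (galZero 𝒜) (nrdImage 𝒜) := by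
  rintro g _ ⟨x, rfl⟩
  obtain ⟨b, rfl⟩ := conjGal_surjective 𝒜 g
  exact ⟨conjUnits 𝒜 b x, unitsNrd_conjUnits 𝒜 b x⟩

theorem unitsNrd_mem_tateKer_iff (x : (degZero 𝒜)ˣ) :
    unitsNrd (degZero 𝒜) x ∈ tateKer (galZero 𝒜) (nrdImage 𝒜) ↔ x ∈ (tildeN 𝒜).ker := by
  have h : ((∏ᶠ g : galZero 𝒜, g • (unitsNrd (degZero 𝒜) x : (centerZero 𝒜)ˣ) :
      (centerZero 𝒜)ˣ) : centerZero 𝒜) = algebraMap (baseZero 𝒜) _ (tildeN 𝒜 x : baseZero 𝒜) := by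
    have h1 := (Units.coeHom (centerZero 𝒜)).map_finprod_of_injective Units.val_injective
      (fun g : galZero 𝒜 => g • (unitsNrd (degZero 𝒜) x : (centerZero 𝒜)ˣ))
    exact h1.trans ((galZero_galois 𝒜).2.2 _).symm
  have h2 : unitsNrd (degZero 𝒜) x ∈ tateKer (galZero 𝒜) (nrdImage 𝒜)
      ↔ ∏ᶠ g : galZero 𝒜, g • (unitsNrd (degZero 𝒜) x : (centerZero 𝒜)ˣ) = 1 :=
    ⟨fun h => h.2, fun h => ⟨⟨x, rfl⟩, h⟩⟩
  rw [h2, ← Units.val_inj, h, Units.val_one, MonoidHom.mem_ker, ← Units.val_inj, Units.val_one]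
  exact map_eq_one_iff (algebraMap (baseZero 𝒜) (centerZero 𝒜)) Subtype.val_injective

/-- `I_G(Nrd(E₀^*))` is the image of `[E₀^*, E^*]`, because `G` acts by conjugations. -/
theorem tateAug_eq_map :
    tateAug (galZero 𝒜) (nrdImage 𝒜) = (mixedCommZero 𝒜).map (unitsNrd (degZero 𝒜)) := by
  rw [mixedCommZero_eq_closure, MonoidHom.map_closure, tateAug]
  congr 1
  ext z
  constructor
  · rintro ⟨_, ⟨a, rfl⟩, g, rfl⟩
    obtain ⟨b, rfl⟩ := conjGal_surjective 𝒜 g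
    refine ⟨_, ⟨a, b, rfl⟩, ?_⟩
    rw [map_mul, map_inv, unitsNrd_conjUnits, ← div_eq_mul_inv]
    rfl
  · rintro ⟨_, ⟨a, b, rfl⟩, rfl⟩
    refine ⟨_, ⟨a, rfl⟩, conjGal 𝒜 b, ?_⟩
    rw [map_mul, map_inv, unitsNrd_conjUnits, ← div_eq_mul_inv]
    rfl

end TateNrd

/-! ### The exact diagram -/

section Diagram

variable {Γ : Type v} [AddCommGroup Γ] [IsAddTorsionFree Γ] [DecidableEq Γ] {E : Type u} [Ring E]
variable (𝒜 : Γ → AddSubgroup E) [GradedRing 𝒜] [hE : IsGradedDivisionRing 𝒜]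

omit [IsAddTorsionFree Γ] hE in
theorem commutator_degZero_le : commutator (degZero 𝒜)ˣ ≤ mixedCommZero 𝒜 := by
  rw [mixedCommZero, ← Subgroup.map_le_iff_le_comap, commutator_def, Subgroup.map_commutator]
  refine Subgroup.commutator_mono ?_ le_top
  rw [← MonoidHom.range_eq_map]

omit [IsAddTorsionFree Γ] hE in
theorem normOne_degZero_le_ker : normOne (degZero 𝒜) ≤ (tildeN 𝒜).ker := by
  intro x hx
  rw [normOne, MonoidHom.mem_ker] at hx
  rw [MonoidHom.mem_ker, tildeN, MonoidHom.comp_apply, hx, map_one]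

variable [Module.Finite (Subring.center E) E]

/-- The map `SK₁(E₀) → ker Ñ / [E₀^*, E^*]`. -/
def skToKerN : SK1 (degZero 𝒜) →* KerNQuot 𝒜 :=
  QuotientGroup.map _ _ (Subgroup.inclusion (normOne_degZero_le_ker 𝒜))
    fun _ hx => commutator_degZero_le 𝒜 hx

/-- The map `ker Ñ / [E₀^*, E^*] → Ĥ⁻¹(G, Nrd(E₀^*))`. -/
def kerNToTate : KerNQuot 𝒜 →* TateHNegOne (galZero 𝒜) (nrdImage 𝒜) :=
  QuotientGroup.map _ _
    (((unitsNrd (degZero 𝒜)).comp (tildeN 𝒜).ker.subtype).codRestrict _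
      fun x => (unitsNrd_mem_tateKer_iff 𝒜 x).mpr x.2)
    fun x hx => by
      change unitsNrd (degZero 𝒜) x ∈ tateAug (galZero 𝒜) (nrdImage 𝒜)
      rw [tateAug_eq_map]
      exact ⟨x, hx, rfl⟩

/-- The projection `E^(1) / [E₀^*, E^*] → SK₁(E)`. -/
def normOneToSK : NormOneQuot 𝒜 →* SK1 E :=
  QuotientGroup.map _ _ (MonoidHom.id _) fun _ hx => mixedComm_le_commutator 𝒜 hx

/-- The inclusion `ker Ñ / [E₀^*, E^*] → E^(1) / [E₀^*, E^*]`. -/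
def kerNToNormOne : KerNQuot 𝒜 →* NormOneQuot 𝒜 :=
  QuotientGroup.map _ _
    (((unitsIncl 𝒜).comp (tildeN 𝒜).ker.subtype).codRestrict (normOne E) fun x =>
      (unitsIncl_mem_normOne_iff 𝒜 x).mpr (by
        rw [MonoidHom.mem_ker.mp x.2, one_pow]))
    fun _ hx => hx

/-- The map `Ñ` on `E^(1)`, which lies in `E₀^*`. -/
def tildeNOnNormOne : normOne E →* (baseZero 𝒜)ˣ :=
  ((tildeN 𝒜).comp (MonoidHom.ofInjective (unitsIncl_injective 𝒜)).symm.toMonoidHom).comp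
    (Subgroup.inclusion (normOne_le_range 𝒜))

theorem tildeNOnNormOne_unitsIncl (x : (degZero 𝒜)ˣ) (hx : unitsIncl 𝒜 x ∈ normOne E) :
    tildeNOnNormOne 𝒜 ⟨unitsIncl 𝒜 x, hx⟩ = tildeN 𝒜 x := by
  change tildeN 𝒜 ((MonoidHom.ofInjective (unitsIncl_injective 𝒜)).symm _) = _
  congr 1
  rw [MulEquiv.symm_apply_eq]
  rfl

/-- The map `E^(1) / [E₀^*, E^*] → μ_δ(T₀) ∩ Ñ(E₀^*)` induced by `Ñ`. -/
def normOneToMu : NormOneQuot 𝒜 →* muImage 𝒜 :=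
  QuotientGroup.lift _ ((tildeNOnNormOne 𝒜).codRestrict (muImage 𝒜) (by
    rintro ⟨w, hw⟩
    obtain ⟨x, rfl⟩ := normOne_le_range 𝒜 hw
    rw [tildeNOnNormOne_unitsIncl]
    exact ⟨(mem_rootsOfUnity _ _).mpr ((unitsIncl_mem_normOne_iff 𝒜 x).mp hw), x, rfl⟩)) (by
    rintro ⟨w, hw⟩ h
    obtain ⟨x, rfl⟩ := normOne_le_range 𝒜 hw
    apply Subtype.ext
    change tildeNOnNormOne 𝒜 _ = 1
    rw [tildeNOnNormOne_unitsIncl]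
    exact mixedCommZero_le_ker 𝒜 h)

theorem coe_normOneToMu (x : (degZero 𝒜)ˣ) (hx : unitsIncl 𝒜 x ∈ normOne E) :
    (normOneToMu 𝒜 (QuotientGroup.mk ⟨unitsIncl 𝒜 x, hx⟩) : (baseZero 𝒜)ˣ) = tildeN 𝒜 x :=
  tildeNOnNormOne_unitsIncl 𝒜 x hx

theorem kerNToTate_surjective : Function.Surjective (kerNToTate 𝒜) := by
  intro y
  induction y using QuotientGroup.induction_on with
  | _ y =>
  obtain ⟨_, ⟨x, rfl⟩, hx⟩ := y
  exact ⟨QuotientGroup.mk ⟨x, (unitsNrd_mem_tateKer_iff 𝒜 x).mp ⟨⟨x, rfl⟩, hx⟩⟩, rfl⟩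

theorem mulExact_skToKerN : Function.MulExact (skToKerN 𝒜) (kerNToTate 𝒜) := by
  intro y
  induction y using QuotientGroup.induction_on with
  | _ y =>
  have h1 : kerNToTate 𝒜 (QuotientGroup.mk y) = 1
      ↔ unitsNrd (degZero 𝒜) y ∈ tateAug (galZero 𝒜) (nrdImage 𝒜) :=
    (QuotientGroup.eq_one_iff _).trans Subgroup.mem_subgroupOf
  rw [h1, tateAug_eq_map]
  constructor
  · rintro ⟨c, hc, hcy⟩
    have hy : (c⁻¹ * y : (degZero 𝒜)ˣ) ∈ normOne (degZero 𝒜) := by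
      rw [normOne, MonoidHom.mem_ker, map_mul, map_inv, hcy, inv_mul_cancel]
    refine ⟨QuotientGroup.mk ⟨_, hy⟩, ?_⟩
    refine QuotientGroup.eq.mpr (Subgroup.mem_subgroupOf.mpr ?_)
    change (c⁻¹ * y : (degZero 𝒜)ˣ)⁻¹ * y ∈ mixedCommZero 𝒜
    have := (mixedCommZero_normal 𝒜).conj_mem c hc (y : (degZero 𝒜)ˣ)⁻¹
    convert this using 1
    group
  · rintro ⟨x, hx⟩
    induction x using QuotientGroup.induction_on with
    | _ x =>
    have h2 : (x : (degZero 𝒜)ˣ)⁻¹ * y ∈ mixedCommZero 𝒜 :=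
      Subgroup.mem_subgroupOf.mp (QuotientGroup.eq.mp hx)
    refine ⟨_, h2, ?_⟩
    have h3 : unitsNrd (degZero 𝒜) x = 1 := x.2
    rw [map_mul, map_inv, h3, inv_one, one_mul]

omit [Module.Finite (Subring.center E) E] in
theorem normOneToSK_surjective : Function.Surjective (normOneToSK 𝒜) := by
  intro y
  induction y using QuotientGroup.induction_on with
  | _ y => exact ⟨QuotientGroup.mk y, rfl⟩

theorem kerNToNormOne_injective : Function.Injective (kerNToNormOne 𝒜) := by
  rw [injective_iff_map_eq_one]
  intro y hy
  induction y using QuotientGroup.induction_on with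
  | _ y =>
  have h : unitsIncl 𝒜 y ∈ mixedComm 𝒜 :=
    Subgroup.mem_subgroupOf.mp ((QuotientGroup.eq_one_iff _).mp hy)
  exact (QuotientGroup.eq_one_iff _).mpr (Subgroup.mem_subgroupOf.mpr h)

theorem mulExact_kerNToNormOne : Function.MulExact (kerNToNormOne 𝒜) (normOneToMu 𝒜) := by
  intro y
  induction y using QuotientGroup.induction_on with
  | _ y =>
  obtain ⟨w, hw⟩ := y
  obtain ⟨x, rfl⟩ := normOne_le_range 𝒜 hw
  rw [← Subtype.val_inj]
  constructor
  · intro h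
    exact ⟨QuotientGroup.mk ⟨x, (coe_normOneToMu 𝒜 x hw).symm.trans h⟩, rfl⟩
  · rintro ⟨z, hz⟩
    induction z using QuotientGroup.induction_on with
    | _ z =>
    rw [← hz]
    exact (coe_normOneToMu 𝒜 z _).trans z.2

theorem normOneToMu_surjective : Function.Surjective (normOneToMu 𝒜) := by
  rintro ⟨_, h, x, rfl⟩
  have hx := (unitsIncl_mem_normOne_iff 𝒜 x).mpr ((mem_rootsOfUnity _ _).mp h)
  exact ⟨QuotientGroup.mk ⟨_, hx⟩, Subtype.ext (coe_normOneToMu 𝒜 x hx)⟩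

/-- Exactness of the second row, for any map with the prescribed values on commutators. -/
theorem mulExact_normOneToSK (g : Multiplicative (⋀[ℤ]^2 (GradeQuot 𝒜)) →* NormOneQuot 𝒜)
    (hg : ∀ (γ δ : gradeGroup 𝒜) (a b : Eˣ), (a : E) ∈ 𝒜 γ → (b : E) ∈ 𝒜 δ →
      g (Multiplicative.ofAdd (exteriorPower.ιMulti ℤ 2
        ![(QuotientAddGroup.mk γ : GradeQuot 𝒜), (QuotientAddGroup.mk δ : GradeQuot 𝒜)]))
        = commClass 𝒜 a b) :
    Function.MulExact g (normOneToSK 𝒜) := by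
  have hker : ∀ y : normOne E, normOneToSK 𝒜 (QuotientGroup.mk y) = 1
      ↔ (y : Eˣ) ∈ commutator Eˣ := fun y =>
    (QuotientGroup.eq_one_iff _).trans Subgroup.mem_subgroupOf
  have hcomm : ∀ a b : Eˣ, commClass 𝒜 a b ∈ g.range := by
    have := hE.nontrivial
    intro a b
    obtain ⟨γ, hγ⟩ := exists_mem_of_unit 𝒜 a
    obtain ⟨δ, hδ⟩ := exists_mem_of_unit 𝒜 b
    exact ⟨_, hg ⟨γ, a, hγ, Subring.mem_top _, a.ne_zero⟩ ⟨δ, b, hδ, Subring.mem_top _, b.ne_zero⟩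
      a b hγ hδ⟩
  intro y
  constructor
  · intro hy
    induction y using QuotientGroup.induction_on with
    | _ y =>
    rw [hker] at hy
    have hle : commutator Eˣ ≤ (g.range.comap (QuotientGroup.mk'
        ((mixedComm 𝒜).subgroupOf (normOne E)))).map (normOne E).subtype := by
      rw [commutator_def, Subgroup.commutator_le]
      intro a _ b _
      exact ⟨⟨_, commutatorElement_mem_normOne a b⟩, hcomm a b, rfl⟩
    obtain ⟨z, hz, hzy⟩ := hle hy
    rw [show y = z from Subtype.ext hzy.symm]
    exact hz
  · rintro ⟨z, rfl⟩
    have hz : Multiplicative.toAdd z ∈ Submodule.span ℤ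
        (Set.range (exteriorPower.ιMulti ℤ 2 (M := GradeQuot 𝒜))) := by
      rw [exteriorPower.ιMulti_span]
      trivial
    change normOneToSK 𝒜 (g (Multiplicative.ofAdd (Multiplicative.toAdd z))) = 1
    generalize Multiplicative.toAdd z = t at hz ⊢
    induction hz using Submodule.span_induction with
    | mem x hx =>
      obtain ⟨w, rfl⟩ := hx
      obtain ⟨a, γ, ha, hγ⟩ := exists_unit_of_gradeQuot 𝒜 (w 0)
      obtain ⟨b, δ, hb, hδ⟩ := exists_unit_of_gradeQuot 𝒜 (w 1)
      have hw : w = ![(QuotientAddGroup.mk γ : GradeQuot 𝒜), QuotientAddGroup.mk δ] := by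
        ext i
        fin_cases i
        · exact hγ.symm
        · exact hδ.symm
      rw [hw, hg γ δ a b ha hb, commClass, hker]
      exact Subgroup.commutator_mem_commutator (Subgroup.mem_top a) (Subgroup.mem_top b)
    | zero => rw [ofAdd_zero, map_one, map_one]
    | add x y _ _ hx hy => rw [ofAdd_add, map_mul, map_mul, hx, hy, one_mul]
    | smul n x _ hx => rw [ofAdd_zsmul, map_zpow, map_zpow, hx, one_zpow]

end Diagram

end

theorem mainTheorem4 {Γ : Type v} [AddCommGroup Γ] [IsAddTorsionFree Γ] [DecidableEq Γ]
    {E : Type u} [Ring E] (𝒜 : Γ → AddSubgroup E) [GradedRing 𝒜] [IsGradedDivisionRing 𝒜]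
    [Module.Finite (Subring.center E) E] :
    -- the objects of the diagram are well defined
    (∃! f : E →* Subring.center E, IsReducedNorm E f) ∧
    (∃! f : degZero 𝒜 →* centerZero 𝒜, IsReducedNorm (degZero 𝒜) f) ∧
    algIndex E ^ 2 = Module.finrank (Subring.center E) E ∧
    algIndex (degZero 𝒜) ^ 2 = Module.finrank (centerZero 𝒜) (degZero 𝒜) ∧
    0 < algIndex E ∧
    deltaE 𝒜 * (algIndex (degZero 𝒜) * Module.finrank (baseZero 𝒜) (centerZero 𝒜))
      = algIndex E ∧
    IsField (baseZero 𝒜) ∧ IsField (centerZero 𝒜) ∧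
    IsGaloisGroup (galZero 𝒜) (baseZero 𝒜) (centerZero 𝒜) ∧
    IsStableSubgroup (galZero 𝒜) (nrdImage 𝒜) ∧
    mixedCommZero 𝒜 ≤ (tildeN 𝒜).ker ∧
    mixedComm 𝒜 ≤ normOne E ∧
    normOne E ≤ (unitsIncl 𝒜).range ∧
    ∃ (_ : Finite (galZero 𝒜))
      (f₁ : SK1 (degZero 𝒜) →* KerNQuot 𝒜)
      (f₂ : KerNQuot 𝒜 →* TateHNegOne (galZero 𝒜) (nrdImage 𝒜))
      (g₁ : Multiplicative (⋀[ℤ]^2 (GradeQuot 𝒜)) →* NormOneQuot 𝒜)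
      (g₂ : NormOneQuot 𝒜 →* SK1 E)
      (h₁ : KerNQuot 𝒜 →* NormOneQuot 𝒜)
      (h₂ : NormOneQuot 𝒜 →* muImage 𝒜),
      -- the maps: `f₁` and `h₁` come from inclusions, `f₂` from `Nrd_{E₀}`, `g₁` from commutators,
      -- `g₂` is the projection, `h₂` comes from `Ñ`
      (∀ x : normOne (degZero 𝒜), ∃ hx : (x : (degZero 𝒜)ˣ) ∈ (tildeN 𝒜).ker,
        f₁ (QuotientGroup.mk x) = QuotientGroup.mk ⟨x, hx⟩) ∧
      (∀ x : (tildeN 𝒜).ker,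
        ∃ hx : unitsNrd (degZero 𝒜) x ∈ tateKer (galZero 𝒜) (nrdImage 𝒜),
        f₂ (QuotientGroup.mk x) = QuotientGroup.mk ⟨unitsNrd (degZero 𝒜) x, hx⟩) ∧
      (∀ (γ δ : gradeGroup 𝒜) (a b : Eˣ), (a : E) ∈ 𝒜 γ → (b : E) ∈ 𝒜 δ →
        ∃ hab : a * b * a⁻¹ * b⁻¹ ∈ normOne E,
        g₁ (Multiplicative.ofAdd (exteriorPower.ιMulti ℤ 2
            ![(QuotientAddGroup.mk γ : GradeQuot 𝒜), (QuotientAddGroup.mk δ : GradeQuot 𝒜)]))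
          = QuotientGroup.mk ⟨a * b * a⁻¹ * b⁻¹, hab⟩) ∧
      (∀ x : normOne E, g₂ (QuotientGroup.mk x) = QuotientGroup.mk x) ∧
      (∀ x : (tildeN 𝒜).ker, ∃ hx : unitsIncl 𝒜 x ∈ normOne E,
        h₁ (QuotientGroup.mk x) = QuotientGroup.mk ⟨unitsIncl 𝒜 x, hx⟩) ∧
      (∀ (x : (degZero 𝒜)ˣ) (hx : unitsIncl 𝒜 x ∈ normOne E),
        (h₂ (QuotientGroup.mk ⟨unitsIncl 𝒜 x, hx⟩) : (baseZero 𝒜)ˣ) = tildeN 𝒜 x) ∧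
      -- the upper row is exact
      Function.MulExact f₁ f₂ ∧ Function.Surjective f₂ ∧
      -- the lower row is exact
      Function.MulExact g₁ g₂ ∧ Function.Surjective g₂ ∧
      -- the column is exact
      Function.Injective h₁ ∧ Function.MulExact h₁ h₂ ∧ Function.Surjective h₂ := by
  obtain ⟨g, hg⟩ := exists_commutator_map 𝒜
  exact ⟨existsUnique_isReducedNorm_of_graded 𝒜,
    existsUnique_isReducedNorm_of_graded (trivialGrading (degZero 𝒜)),
    algIndex_sq_of_graded 𝒜, algIndex_sq_of_graded (trivialGrading (degZero 𝒜)),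
    algIndex_pos_of_graded 𝒜, deltaE_mul 𝒜, isField_baseZero 𝒜, isField_centerZero 𝒜,
    isGaloisGroup_galZero 𝒜, isStableSubgroup_nrdImage 𝒜, mixedCommZero_le_ker 𝒜,
    (mixedComm_le_commutator 𝒜).trans (commutator_le_normOne E), normOne_le_range 𝒜,
    finite_galZero 𝒜, skToKerN 𝒜, kerNToTate 𝒜, g, normOneToSK 𝒜, kerNToNormOne 𝒜,
    normOneToMu 𝒜,
    fun x => ⟨normOne_degZero_le_ker 𝒜 x.2, rfl⟩,
    fun x => ⟨(unitsNrd_mem_tateKer_iff 𝒜 x).mpr x.2, rfl⟩,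
    fun γ δ a b ha hb => ⟨commutatorElement_mem_normOne a b, hg γ δ a b ha hb⟩,
    fun x => rfl,
    fun x => ⟨(unitsIncl_mem_normOne_iff 𝒜 x).mpr (by rw [MonoidHom.mem_ker.mp x.2, one_pow]), rfl⟩,
    coe_normOneToMu 𝒜,
    mulExact_skToKerN 𝒜, kerNToTate_surjective 𝒜,
    mulExact_normOneToSK 𝒜 g hg, normOneToSK_surjective 𝒜,
    kerNToNormOne_injective 𝒜, mulExact_kerNToNormOne 𝒜, normOneToMu_surjective 𝒜⟩
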